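/- Permutations are finite words of distinct positive integers; $S_n$ is the set of permutations of $\{1,\dots,n\}$. West's stack-sorting map $s$ fixes the empty word and satisfies $s(LmR)=s(L)\,s(R)\,m$, where $m$ is the largest entry. A permutation $\pi$ is sorted if $|s^{-1}(\pi)|\ge 1$ and uniquely sorted if $|s^{-1}(\pi)|=1$. Let $\mathcal U_n(\tau)$ be the set of uniquely sorted permutations in $S_n$ that avoid the pattern $\tau$, and let $\mathrm{Des}(\pi)=\{i:\ 1\le i\le n-1,\ \pi_i>\pi_{i+1}\}$ for $\pi=\pi_1\cdots\pi_n$. For $\pi\in S_n$ let $\mathrm{rev}(\pi)=\pi_n\cdots\pi_1$ and $\mathrm{rot}(\pi)=\mathrm{rev}(\pi^{-1})$. For $1\le i\le n$ let $L_i$ (respectively $R_i$) be the set of entries smaller than $i$ that lie to the left (respectively right) of the entry $i$ in $\pi$. The permutation $\mathrm{swu}_i(\pi)$ is obtained from $\pi$ by keeping every entry $\ge i$, replacing the $m$-th smallest element of $R_i$ by $m$, and replacing the $m$-th largest element of $L_i$ by $i-m$. Put $\mathrm{swd}_i=\mathrm{rev}\circ\mathrm{swu}_i\circ\mathrm{rev}$,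 $\mathrm{swl}_i=\mathrm{rot}^{-1}\circ\mathrm{swu}_i\circ\mathrm{rot}$, $\mathrm{swr}_i=\mathrm{rot}^{-1}\circ\mathrm{swd}_i\circ\mathrm{rot}$, $\mathrm{swl}=\mathrm{swl}_1\circ\cdots\circ\mathrm{swl}_n$ and $\mathrm{swr}=\mathrm{swr}_1\circ\cdots\circ\mathrm{swr}_n$. Let $\mathbf D_k$ be the set of Dyck paths of semilength $k$, seen as words in $U$ and $D$. For $\Lambda=UD^{\gamma_1}UD^{\gamma_2}\cdots UD^{\gamma_k}\in\mathbf D_k$ and $1\le j\le k$, let the longevity $\mathrm{lon}_j(\Lambda)$ be the smallest integer $t\ge 0$ with $\gamma_j+\gamma_{j+1}+\cdots+\gamma_{j+t}>t$. The Tamari lattice $\mathcal L_k^T$ is $\mathbf D_k$ ordered by $\Lambda\le_T\Lambda'$ if and only if $\mathrm{lon}_j(\Lambda)\le\mathrm{lon}_j(\Lambda')$ for all $1\le j\le k$, and $\mathrm{Int}(\mathcal L_k^T)$ is the set of pairs $(\Lambda,\Lambda')\in\mathbf D_k\times\mathbf D_k$ with $\Lambda\le_T\Lambda'$. For $\pi\in\mathcal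 U_{2k+1}(312)$ let $\mathrm{DL}_k(\pi)=(\Lambda_1\cdots\Lambda_{2k},\ \Lambda'_1\cdots\Lambda'_{2k})$, where $\Lambda_i=D$ if $2k+1-i\in\mathrm{Des}(\pi)$ and $\Lambda_i=U$ otherwise, and $\Lambda'_i=U$ if $i\in\mathrm{Des}(\mathrm{rot}(\pi))$ and $\Lambda'_i=D$ otherwise. **Theorem.** For every integer $k\ge 0$: 1. $\mathrm{swl}$ maps $\mathcal U_{2k+1}(132)$ into $\mathcal U_{2k+1}(312)$, so that $\mathrm{DL}_k\circ\mathrm{swl}$ is defined on $\mathcal U_{2k+1}(132)$; 2. $\mathrm{DL}_k\circ\mathrm{swl}$ is a bijection from $\mathcal U_{2k+1}(132)$ onto $\mathrm{Int}(\mathcal L_k^T)$; 3. for every $\pi\in\mathcal U_{2k+1}(312)$, the permutation $\mathrm{swr}(\pi)$ is sorted if and only if $\mathrm{DL}_k(\pi)\in\mathrm{Int}(\mathcal L_k^T)$. -/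

import Mathlib

namespace CatalanIntervals

/-! ### Permutations as words

A permutation is a finite word of distinct positive integers, in one-line notation.  The entry in
position `i` (positions start at `1`) of the word `π` is `π.getD (i - 1) 0`. -/

/-- A permutation: a finite word over the positive integers without repeated letters. -/
def IsPermutation (π : List ℕ) : Prop := π.Nodup ∧ ∀ x ∈ π, 0 < x

/-- `S_n`, the set of permutations of `{1, …, n}`. -/
def PermWords (n : ℕ) : Set (List ℕ) := {π | π.Perm (List.range' 1 n)}

/-- The normalization of a permutation: its `i`-th smallest entry is replaced by `i`. -/
def normalize (π : List ℕ) : List ℕ := π.map fun x => (π.filter (· ≤ x)).length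

/-- `σ` contains the pattern `τ`: some subword of `σ` has the same relative order as `τ`. -/
def Contains (σ τ : List ℕ) : Prop := ∃ w, w.Sublist σ ∧ normalize w = normalize τ

/-- `Des π`, the set of indices `i ∈ {1, …, n - 1}` with `π_i > π_{i+1}`. -/
def Des (π : List ℕ) : Finset ℕ :=
  (Finset.Ico 1 π.length).filter fun i => π.getD i 0 < π.getD (i - 1) 0

/-! ### The stack-sorting map -/

/-- West's stack-sorting map `s`: the empty word is fixed, and `s (L m R) = s(L) s(R) m`, where
`m` is the largest entry. -/
def stackSort : List ℕ → List ℕ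
  | [] => []
  | a :: l =>
    let m := (a :: l).max (List.cons_ne_nil a l)
    stackSort ((a :: l).take ((a :: l).idxOf m)) ++
      stackSort ((a :: l).drop ((a :: l).idxOf m + 1)) ++ [m]
termination_by π => π.length
decreasing_by
  · have h := List.idxOf_lt_length_of_mem (List.max_mem (List.cons_ne_nil a l))
    simp only [List.length_take]
    omega
  · simp only [List.length_drop, List.length_cons]
    omega

/-- The fertility of `π`: the number of preimages of `π` under the stack-sorting map. -/
noncomputable def fertility (π : List ℕ) : ℕ∞ :=
  {σ : List ℕ | IsPermutation σ ∧ stackSort σ = π}.encard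

/-- A permutation is sorted if its fertility is positive. -/
def IsSorted (π : List ℕ) : Prop := 0 < fertility π

/-- A permutation is uniquely sorted if its fertility is `1`. -/
def IsUniquelySorted (π : List ℕ) : Prop := fertility π = 1

/-- `U_n(τ)`, the set of uniquely sorted permutations in `S_n` that avoid the pattern `τ`. -/
def UniquelySortedAv (n : ℕ) (τ : List ℕ) : Set (List ℕ) :=
  {π | π ∈ PermWords n ∧ IsUniquelySorted π ∧ ¬ Contains π τ}

/-! ### Sliding operators on `S_n` -/

/-- The inverse of `π ∈ S_n`: the entry `i` appears in position `π_i`. -/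
def permInv (π : List ℕ) : List ℕ := (List.range' 1 π.length).map fun v => π.idxOf v + 1

/-- Counterclockwise rotation of the plot by a right angle, `rot π = rev (π⁻¹)`. -/
def rot (π : List ℕ) : List ℕ := (permInv π).reverse

/-- The inverse of `rot`: clockwise rotation of the plot by a right angle. -/
def rotInv (π : List ℕ) : List ℕ := permInv π.reverse

/-- The entries smaller than `i` that lie to the left of the entry `i`. -/
def leftSmaller (i : ℕ) (π : List ℕ) : List ℕ := (π.take (π.idxOf i)).filter (· < i)

/-- The entries smaller than `i` that lie to the right of the entry `i`. -/
def rightSmaller (i : ℕ) (π : List ℕ) : List ℕ := (π.drop (π.idxOf i)).filter (· < i)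

/-- `swu_i`: entries `≥ i` stay, the `m`-th smallest entry of `rightSmaller i π` becomes `m`, and
the `m`-th largest entry of `leftSmaller i π` becomes `i - m`. -/
def swuAt (i : ℕ) (π : List ℕ) : List ℕ :=
  π.map fun x =>
    if i ≤ x then x
    else if x ∈ rightSmaller i π then ((rightSmaller i π).filter (· ≤ x)).length
    else i - ((leftSmaller i π).filter (x ≤ ·)).length

/-- `swd_i = rev ∘ swu_i ∘ rev`. -/
def swdAt (i : ℕ) (π : List ℕ) : List ℕ := (swuAt i π.reverse).reverse

/-- `swl_i = rot⁻¹ ∘ swu_i ∘ rot`. -/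
def swlAt (i : ℕ) (π : List ℕ) : List ℕ := rotInv (swuAt i (rot π))

/-- `swr_i = rot⁻¹ ∘ swd_i ∘ rot`. -/
def swrAt (i : ℕ) (π : List ℕ) : List ℕ := rotInv (swdAt i (rot π))

/-- `swl = swl_1 ∘ swl_2 ∘ ⋯ ∘ swl_n` on `S_n`. -/
def swl (π : List ℕ) : List ℕ := (List.range' 1 π.length).foldr swlAt π

/-- `swr = swr_1 ∘ swr_2 ∘ ⋯ ∘ swr_n` on `S_n`. -/
def swr (π : List ℕ) : List ℕ := (List.range' 1 π.length).foldr swrAt π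

/-! ### Dyck paths and the Tamari order -/

/-- `D_k`, the set of Dyck paths of semilength `k`, as words in the letters `U` and `D`. -/
def DyckPaths (k : ℕ) : Set (List DyckStep) :=
  {w | ∃ p : DyckWord, p.semilength = k ∧ p.toList = w}

/-- For `w = U D^{γ_1} U D^{γ_2} ⋯ U D^{γ_k}`, the list `[γ_1, …, γ_k]`. -/
def downRuns : List DyckStep → List ℕ
  | [] => []
  | DyckStep.U :: w => (w.takeWhile (· = DyckStep.D)).length :: downRuns w
  | DyckStep.D :: w => downRuns w

/-- The longevity `lon_j` of the `j`-th up step (`1 ≤ j ≤ k`): the smallest `t` such that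
`γ_j + γ_{j+1} + ⋯ + γ_{j+t} > t`.  For a Dyck path there is such a `t` with `j + t ≤ k`. -/
noncomputable def longevity (w : List DyckStep) (j : ℕ) : ℕ :=
  sInf {t : ℕ | t < ∑ i ∈ Finset.Icc j (j + t), (downRuns w).getD (i - 1) 0}

/-- The order of the `k`-th Tamari lattice: `Λ ≤_T Λ'` iff `lon_j Λ ≤ lon_j Λ'` for all
`j ∈ {1, …, k}`. -/
def TamariLE (k : ℕ) (v w : List DyckStep) : Prop :=
  ∀ j ∈ Finset.Icc 1 k, longevity v j ≤ longevity w j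

/-- The intervals of the `k`-th Tamari lattice: pairs `(Λ, Λ')` in `D_k` with `Λ ≤_T Λ'`. -/
def tamariIntervals (k : ℕ) : Set (List DyckStep × List DyckStep) :=
  {P | P.1 ∈ DyckPaths k ∧ P.2 ∈ DyckPaths k ∧ TamariLE k P.1 P.2}

/-- `DL_k π = (Λ, Λ')`, with `n = 2k + 1`: for `1 ≤ i ≤ 2k`, `Λ_i = D` iff `n - i ∈ Des π`, and
`Λ'_i = U` iff `i ∈ Des (rot π)`. -/
def DL (k : ℕ) (π : List ℕ) : List DyckStep × List DyckStep :=
  ((List.range' 1 (2 * k)).map fun i =>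
      if 2 * k + 1 - i ∈ Des π then DyckStep.D else DyckStep.U,
    (List.range' 1 (2 * k)).map fun i =>
      if i ∈ Des (rot π) then DyckStep.U else DyckStep.D)

end CatalanIntervals

open CatalanIntervals

namespace CatalanIntervals

open DyckStep

/-! A nonempty sorted word is built by nodes `A ++ B ++ [m]` with `A`, `B` sorted and `m` maximal. A
node adds one letter and at most one descent, so a sorted word of length `n ≥ 1` has at most `(n -
1) / 2` descents. Equality (`TightWord`) means that every node has two nonempty blocks with a
descent between them, or none. This happens exactly for fertility one (`isUniquelySorted_iff`).

Label the nodes of a binary tree in inorder. The words avoiding 312 are the left-right-root readings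
(`post`), and those avoiding 132 are the right-left-root readings (`anti`). In the rotated plot a
sliding operator exchanges the value ranges of the two subtrees of one node. Hence `swl` takes
`anti` to `post` (`swl_anti`), `swr` takes `post` to `anti` (`swr_post`), and the whole theorem
becomes one about trees. In both readings the descents correspond to the right edges, so tightness
forces equally many left and right edges. For such a tree `anti` is tight if and only if the tree is
`LeftHeavy` (`tightWord_anti_iff`), and then `post` is tight too.

The pair `DL` of a `post` word is `(edgePath, canopy)` (`DL_post`). The canopy arises from the edge
path by delaying the down step of each right edge until after the word of the subtree below it. The
longevity of an up step counts the up steps before its matching down step. Comparing these numbers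
shows that the pair is a Tamari interval if and only if the tree is left-heavy
(`leftHeavy_iff_tamariLE`). Finally, the two paths determine the tree (`eq_of_edgePath_of_canopy`),
and a tree exists for every pair of Dyck paths with the first weakly below the second
(`exists_of_runSum_le`), hence for every Tamari interval. -/

/-! ### Descents of words -/

/-- The word of steps between consecutive letters: `D` for a descent, `U` otherwise. -/
def stepWord : List ℕ → List DyckStep
  | [] => []
  | [_] => []
  | a :: b :: l => (if b < a then D else U) :: stepWord (b :: l)

/-- The number of descents of a word. -/
def desCount (w : List ℕ) : ℕ := (stepWord w).count D

/-- There is a descent at the junction of the words `A` and `B`. -/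
def Drop (A B : List ℕ) : Prop := ∃ a ∈ A.getLast?, ∃ b ∈ B.head?, b < a

noncomputable instance (A B : List ℕ) : Decidable (Drop A B) := Classical.dec _

@[simp] theorem drop_nil_left (B : List ℕ) : ¬ Drop [] B := by simp [Drop]

@[simp] theorem drop_nil_right (A : List ℕ) : ¬ Drop A [] := by simp [Drop]

@[simp] theorem drop_concat_cons (A B : List ℕ) (a b : ℕ) :
    Drop (A ++ [a]) (b :: B) ↔ b < a := by simp [Drop]

theorem drop_append_left {A : List ℕ} (hA : A ≠ []) (X B : List ℕ) :
    Drop (X ++ A) B ↔ Drop A B := by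
  obtain ⟨A, a, rfl⟩ := (List.eq_nil_or_concat A).resolve_left hA
  simp [Drop]

theorem drop_append_right {B : List ℕ} (hB : B ≠ []) (A Y : List ℕ) :
    Drop A (B ++ Y) ↔ Drop A B := by
  obtain ⟨b, B, rfl⟩ := List.exists_cons_of_ne_nil hB
  simp [Drop]

theorem Drop.of_forall {A B : List ℕ} (hA : A ≠ []) (hB : B ≠ [])
    (h : ∀ a ∈ A, ∀ b ∈ B, b < a) : Drop A B := by
  obtain ⟨A, a, rfl⟩ := (List.eq_nil_or_concat A).resolve_left hA
  obtain ⟨b, B, rfl⟩ := List.exists_cons_of_ne_nil hB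
  simpa using h a (by simp) b (by simp)

theorem not_drop_of_forall {A B : List ℕ} (h : ∀ a ∈ A, ∀ b ∈ B, a < b) : ¬ Drop A B := by
  rintro ⟨a, ha, b, hb, hlt⟩
  exact absurd hlt (h a (List.mem_of_getLast? ha) b (List.mem_of_head? hb)).not_gt

theorem stepWord_append_cons (A B : List ℕ) (a b : ℕ) :
    stepWord (A ++ a :: b :: B) =
      stepWord (A ++ [a]) ++ (if b < a then D else U) :: stepWord (b :: B) := by
  induction A with
  | nil => simp [stepWord]
  | cons x A ih => cases A <;> simp_all [stepWord]

theorem stepWord_append {A B : List ℕ} (hA : A ≠ []) (hB : B ≠ []) :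
    stepWord (A ++ B) = stepWord A ++ (if Drop A B then D else U) :: stepWord B := by
  obtain ⟨A, a, rfl⟩ := (List.eq_nil_or_concat A).resolve_left hA
  obtain ⟨b, B, rfl⟩ := List.exists_cons_of_ne_nil hB
  simpa using stepWord_append_cons A B a b

theorem desCount_append (A B : List ℕ) :
    desCount (A ++ B) = desCount A + desCount B + if Drop A B then 1 else 0 := by
  rcases eq_or_ne A [] with rfl | hA
  · simp [desCount, stepWord]
  rcases eq_or_ne B [] with rfl | hB
  · simp [desCount, stepWord]
  rw [desCount, stepWord_append hA hB]
  split_ifs <;> simp [desCount]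
  omega

@[simp] theorem desCount_nil : desCount [] = 0 := rfl
@[simp] theorem desCount_singleton (x : ℕ) : desCount [x] = 0 := rfl

theorem desCount_concat_of_lt {A : List ℕ} {m : ℕ} (h : ∀ x ∈ A, x < m) :
    desCount (A ++ [m]) = desCount A := by
  rw [desCount_append, if_neg (not_drop_of_forall (by simpa using h))]; simp

theorem length_stepWord (w : List ℕ) : (stepWord w).length = w.length - 1 := by
  induction w with
  | nil => rfl
  | cons a w ih => cases w <;> simp_all [stepWord]

/-! ### Sorted words and their extremal case -/

/-- Words obtained by the recursion that the stack-sorting map follows. -/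
inductive SortedWord : List ℕ → Prop
  | nil : SortedWord []
  | node {A B : List ℕ} {m : ℕ} : SortedWord A → SortedWord B → (∀ x ∈ A ++ B, x < m) →
      SortedWord (A ++ B ++ [m])

/-- Sorted words in which the number of descents is as large as possible. -/
inductive TightWord : List ℕ → Prop
  | single (x : ℕ) : TightWord [x]
  | node {A B : List ℕ} {m : ℕ} : TightWord A → TightWord B → Drop A B →
      (∀ x ∈ A ++ B, x < m) → TightWord (A ++ B ++ [m])

theorem TightWord.ne_nil {w : List ℕ} (h : TightWord w) : w ≠ [] := by
  cases h <;> simp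

theorem TightWord.sortedWord {w : List ℕ} (h : TightWord w) : SortedWord w := by
  induction h with
  | single x => exact SortedWord.node (A := []) (B := []) .nil .nil (by simp)
  | node _ _ _ hm hA hB => exact .node hA hB hm

theorem TightWord.length_eq {w : List ℕ} (h : TightWord w) : w.length = 2 * desCount w + 1 := by
  induction h with
  | single x => simp
  | node _ _ hd hm hA hB =>
    rw [desCount_concat_of_lt hm, desCount_append, if_pos hd]
    simp only [List.length_append, List.length_singleton]
    omega

theorem SortedWord.le_length {w : List ℕ} (h : SortedWord w) (hw : w ≠ []) :
    2 * desCount w + 1 ≤ w.length := by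
  induction h with
  | nil => exact absurd rfl hw
  | @node A B m _ _ hm hA hB =>
    rw [desCount_concat_of_lt hm, desCount_append]
    simp only [List.length_append, List.length_singleton]
    rcases eq_or_ne A [] with rfl | hA'
    · rcases eq_or_ne B [] with rfl | hB'
      · simp
      · have := hB hB'
        simp
        omega
    · have := hA hA'
      rcases eq_or_ne B [] with rfl | hB'
      · simp
        omega
      · have := hB hB'
        split_ifs <;> omega

theorem SortedWord.tightWord {w : List ℕ} (h : SortedWord w)
    (hw : w.length = 2 * desCount w + 1) : TightWord w := by
  induction h with
  | nil => simp at hw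
  | @node A B m hsA hsB hm hA hB =>
    rw [desCount_concat_of_lt hm, desCount_append] at hw
    simp only [List.length_append, List.length_singleton] at hw
    rcases eq_or_ne A [] with rfl | hA'
    · rcases eq_or_ne B [] with rfl | hB'
      · exact .single m
      · have := hsB.le_length hB'
        simp at hw
        omega
    · have := hsA.le_length hA'
      rcases eq_or_ne B [] with rfl | hB'
      · simp at hw
        omega
      · have := hsB.le_length hB'
        split_ifs at hw with hd
        · exact .node (hA (by omega)) (hB (by omega)) hd hm
        · omega

/-- A prefix reaching past `A` gains the descent at the junction, which pays for two letters, while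
`A` itself has equality. -/
theorem TightWord.prefix_length_le {w : List ℕ} (h : TightWord w) {C : List ℕ} (hC : C ≠ [])
    (hp : C <+: w) : C.length ≤ 2 * desCount C + 1 := by
  induction h generalizing C with
  | single x =>
    have := hp.length_le
    simp only [List.length_singleton] at this
    omega
  | @node A B m hA hB hd hm ihA ihB =>
    rcases List.prefix_concat_iff.1 hp with h | h
    · exact h ▸ (TightWord.node hA hB hd hm).length_eq.le
    obtain ⟨E, hE⟩ := h
    rcases List.append_eq_append_iff.1 hE with ⟨C', rfl, _⟩ | ⟨C', rfl, rfl⟩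
    · exact ihA hC (List.prefix_append _ _)
    · have h : C' <+: C' ++ E := List.prefix_append _ _
      rcases eq_or_ne C' [] with rfl | hC'
      · simpa using hA.length_eq.le
      · have h1 := ihB hC' h
        have h2 := hA.length_eq
        have : Drop A C' := by
          rwa [drop_append_right hC'] at hd
        rw [desCount_append, if_pos this, List.length_append]
        omega

/-- A tight word splits in only one way below its last letter. -/
theorem TightWord.split_unique {A B A' B' : List ℕ} (hA : TightWord A) (hB : TightWord B)
    (hd : Drop A B) (hA' : SortedWord A') (hB' : SortedWord B') (h : A' ++ B' = A ++ B) :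
    A' = A ∧ B' = B := by
  have lA := hA.length_eq
  have lB := hB.length_eq
  rcases List.append_eq_append_iff.1 h with ⟨C, rfl, rfl⟩ | ⟨C, rfl, rfl⟩
  · rcases eq_or_ne C [] with rfl | hC
    · simp
    exfalso
    rw [drop_append_left hC] at hd
    -- Moving `C` from `A` to `B` takes the descent at the junction with it, so sortedness of `C ++
    -- B` needs `C.length ≥ 2 * desCount C + 2`. Equality must hold, so `C ++ B` is tight and its
    -- prefix `C` is too long.
    have h1 := hB'.le_length (by simp [hC])
    have h1' := desCount_append C B
    rw [if_pos hd] at h1'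
    have h2 := desCount_append A' C
    simp only [List.length_append] at *
    rcases eq_or_ne A' [] with rfl | hA0
    · simp at h2 lA
      omega
    · have h3 := hA.prefix_length_le hA0 (List.prefix_append _ _)
      have h4 := hA'.le_length hA0
      have h5 : TightWord (C ++ B) := hB'.tightWord (by
        rw [List.length_append]
        split_ifs at h2 <;> omega)
      have h6 := h5.prefix_length_le hC (List.prefix_append _ _)
      omega
  · rcases eq_or_ne C [] with rfl | hC
    · simp
    exfalso
    rw [drop_append_right hC] at hd
    -- Again `C` would need length at least `2 * desCount C + 2`, against the bound for a prefix of
    -- the tight word `B`.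
    have h1 := hA'.le_length (by simp [hC])
    have h2 := hB.prefix_length_le hC (List.prefix_append _ _)
    rw [desCount_append, if_pos hd, List.length_append] at h1
    omega

/-! ### Fertility -/

theorem stackSort_split {L R : List ℕ} {m : ℕ} (h : ∀ x ∈ L ++ R, x < m) :
    stackSort (L ++ m :: R) = stackSort L ++ stackSort R ++ [m] := by
  obtain ⟨a, l, e⟩ := List.exists_cons_of_ne_nil (show L ++ m :: R ≠ [] by simp)
  have hmax : (a :: l).max (List.cons_ne_nil a l) = m := by
    apply le_antisymm
    · have := List.max_mem (List.cons_ne_nil a l)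
      generalize (a :: l).max (List.cons_ne_nil a l) = M at this
      rw [← e, List.mem_append, List.mem_cons] at this
      rcases this with h' | rfl | h'
      · exact (h M (by simp [h'])).le
      · exact le_rfl
      · exact (h M (by simp [h'])).le
    · apply List.le_max_of_mem
      rw [← e]; simp
  have hm : m ∉ L := fun hm => lt_irrefl _ (h m (by simp [hm]))
  have hidx : (a :: l).idxOf m = L.length := by
    rw [← e, List.idxOf_append_of_notMem hm]; simp
  rw [e, stackSort]
  simp only [hmax, hidx]
  rw [← e]
  simp

theorem exists_eq_append_max_cons {w : List ℕ} (hn : w.Nodup) (hw : w ≠ []) :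
    ∃ L m R, w = L ++ m :: R ∧ ∀ x ∈ L ++ R, x < m := by
  obtain ⟨L, R, e⟩ := List.append_of_mem (List.max_mem hw)
  refine ⟨L, _, R, e, fun x hx => lt_of_le_of_ne (List.le_max_of_mem ?_) ?_⟩
  · rw [e]; simp at hx ⊢; tauto
  · rintro rfl
    rw [e] at hn
    exact (List.nodup_middle.1 hn |> List.nodup_cons.1).1 hx

theorem stackSort_induction {P : List ℕ → Prop} (nil : P [])
    (node : ∀ L m R, P L → P R → (∀ x ∈ L ++ R, x < m) → P (L ++ m :: R)) {w : List ℕ}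
    (hw : w.Nodup) : P w := by
  induction hn : w.length using Nat.strong_induction_on generalizing w with
  | _ n ih =>
    rcases eq_or_ne w [] with rfl | h0
    · exact nil
    obtain ⟨L, m, R, rfl, hm⟩ := exists_eq_append_max_cons hw h0
    simp only [List.length_append, List.length_cons] at hn
    have hw' := List.nodup_append.1 hw
    exact node L m R (ih L.length (by omega) hw'.1 rfl)
      (ih R.length (by omega) (List.nodup_cons.1 hw'.2.1).2 rfl) hm

@[simp] theorem stackSort_nil : stackSort [] = [] := by rw [stackSort]

theorem stackSort_perm_and_sortedWord {w : List ℕ} (hw : w.Nodup) :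
    (stackSort w).Perm w ∧ SortedWord (stackSort w) := by
  refine stackSort_induction (P := fun w => (stackSort w).Perm w ∧ SortedWord (stackSort w))
    ?_ ?_ hw
  · simpa using SortedWord.nil
  · rintro L m R ⟨hL, sL⟩ ⟨hR, sR⟩ hm
    rw [stackSort_split hm]
    refine ⟨?_, .node sL sR ?_⟩
    · rw [List.append_assoc]
      exact hL.append ((hR.append_right [m]).trans List.perm_append_comm)
    · simpa only [List.mem_append, hL.mem_iff, hR.mem_iff] using hm

theorem SortedWord.exists_stackSort_eq {w : List ℕ} (h : SortedWord w) :
    ∃ σ : List ℕ, σ.Perm w ∧ stackSort σ = w := by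
  induction h with
  | nil => exact ⟨[], by simp⟩
  | @node A B m _ _ hm hA hB =>
    obtain ⟨L, hL, rfl⟩ := hA
    obtain ⟨R, hR, rfl⟩ := hB
    refine ⟨L ++ m :: R, ?_, stackSort_split ?_⟩
    · rw [List.append_assoc]
      exact hL.append ((List.perm_append_comm (l₁ := [m])).trans (hR.append_right [m]))
    · simpa only [List.mem_append, hL.mem_iff, hR.mem_iff] using hm

theorem exists_of_stackSort_eq_concat {σ V : List ℕ} {m : ℕ} (hn : σ.Nodup)
    (h : stackSort σ = V ++ [m]) :
    ∃ L R, σ = L ++ m :: R ∧ L.Nodup ∧ R.Nodup ∧ stackSort L ++ stackSort R = V := by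
  rcases eq_or_ne σ [] with rfl | h0
  · simp at h
  obtain ⟨L, m', R, rfl, hm⟩ := exists_eq_append_max_cons hn h0
  rw [stackSort_split hm] at h
  obtain ⟨h1, h2⟩ := List.append_inj' h rfl
  obtain rfl : m' = m := by simpa using h2
  have hn' := List.nodup_append.1 hn
  exact ⟨L, R, rfl, hn'.1, (List.nodup_cons.1 hn'.2.1).2, h1⟩

theorem TightWord.stackSort_injective {w : List ℕ} (h : TightWord w) {σ τ : List ℕ}
    (hσ : σ.Nodup) (hτ : τ.Nodup) (eσ : stackSort σ = w) (eτ : stackSort τ = w) : σ = τ := by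
  induction h generalizing σ τ with
  | single x =>
    have h1 := (stackSort_perm_and_sortedWord hσ).1
    have h2 := (stackSort_perm_and_sortedWord hτ).1
    rw [eσ, List.singleton_perm] at h1
    rw [eτ, List.singleton_perm] at h2
    rw [← h1, h2]
  | @node A B m hA hB hd hm ihA ihB =>
    obtain ⟨L, R, rfl, hL, hR, e⟩ := exists_of_stackSort_eq_concat hσ eσ
    obtain ⟨L', R', rfl, hL', hR', e'⟩ := exists_of_stackSort_eq_concat hτ eτ
    have h1 := hA.split_unique hB hd (stackSort_perm_and_sortedWord hL).2
      (stackSort_perm_and_sortedWord hR).2 e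
    have h2 := hA.split_unique hB hd (stackSort_perm_and_sortedWord hL').2
      (stackSort_perm_and_sortedWord hR').2 e'
    rw [ihA hL hL' h1.1 h2.1, ihB hR hR' h1.2 h2.2]

theorem SortedWord.eq_concat {w : List ℕ} (h : SortedWord w) (hw : w ≠ []) :
    ∃ V m, w = V ++ [m] ∧ ∀ x ∈ V, x < m := by
  cases h with
  | nil => exact absurd rfl hw
  | node _ _ hm => exact ⟨_, _, rfl, hm⟩

/-- Without a descent at the junction every letter of `A` is below the first letter of `B`, because
`A` ends in its maximum. So `A` can be absorbed as a block below the leftmost leaf of `B`. This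
supplies the second preimage when a node has no descent between its blocks. -/
theorem SortedWord.append_tightWord {A B : List ℕ} (hA : SortedWord A) (hA0 : A ≠ [])
    (hB : TightWord B) (hd : ¬ Drop A B) (hn : ∀ a ∈ A, a ∉ B) : SortedWord (A ++ B) := by
  obtain ⟨V, a, rfl, ha⟩ := hA.eq_concat hA0
  have key : ∀ x B', B = x :: B' → ∀ y ∈ V ++ [a], y < x := by
    rintro x B' rfl y hy
    rw [drop_concat_cons, not_lt] at hd
    have h1 : a < x := lt_of_le_of_ne hd fun e => hn a (by simp) (by simp [e])
    rcases List.mem_append.1 hy with hy | hy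
    · exact (ha y hy).trans h1
    · rw [List.mem_singleton.1 hy]; exact h1
  induction hB with
  | single x => simpa using SortedWord.node hA .nil (by simpa using key x [] rfl)
  | @node B₁ B₂ m h₁ h₂ hd' hm ih₁ _ =>
    obtain ⟨b, B', rfl⟩ := List.exists_cons_of_ne_nil h₁.ne_nil
    have h3 : SortedWord (V ++ [a] ++ b :: B') := by
      refine ih₁ (by simpa using hd) (fun x hx hx' => hn x hx (by simp at hx' ⊢; tauto)) ?_
      rintro x B'' e y hy
      obtain ⟨rfl, -⟩ := List.cons_eq_cons.1 e
      exact key _ (B' ++ B₂ ++ [m]) (by simp) y hy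
    have := SortedWord.node (m := m) h3 h₂.sortedWord (by
      intro x hx
      rw [List.append_assoc, List.mem_append] at hx
      rcases hx with hx | hx
      · exact (key b (B' ++ B₂ ++ [m]) (by simp) x hx).trans (hm b (by simp))
      · exact hm x hx)
    simpa using this

theorem append_cons_ne {L R σ : List ℕ} {m : ℕ} (hR : R ≠ []) (hm : m ∉ R) :
    L ++ m :: R ≠ σ ++ [m] := by
  intro h
  obtain ⟨R, r, rfl⟩ := (List.eq_nil_or_concat R).resolve_left hR
  have h' : L ++ m :: R ++ [r] = σ ++ [m] := by simpa using h
  have := (List.append_inj' h' rfl).2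
  simp at this
  simp [this] at hm

/-- Each failure of tightness leaves a choice: two preimages of a block, or the maximum placed
either between the blocks or at the end because `A ++ B` is sorted as a single block. -/
theorem SortedWord.tightWord_or_exists_ne {w : List ℕ} (h : SortedWord w) (hw : w ≠ [])
    (hn : w.Nodup) : TightWord w ∨ ∃ σ τ : List ℕ, σ ≠ τ ∧ σ.Perm w ∧ τ.Perm w ∧
      stackSort σ = w ∧ stackSort τ = w := by
  induction h with
  | nil => exact absurd rfl hw
  | @node A B m sA sB hm hA hB =>
    have hmA : ∀ x ∈ A, x < m := fun x hx => hm x (by simp [hx])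
    have hmB : ∀ x ∈ B, x < m := fun x hx => hm x (by simp [hx])
    have perm : ∀ L R : List ℕ, L.Perm A → R.Perm B → (L ++ m :: R).Perm (A ++ B ++ [m]) := by
      intro L R hL hR
      rw [List.append_assoc]
      exact hL.append ((List.perm_append_comm (l₁ := [m])).trans (hR.append_right [m]))
    have srt : ∀ L R : List ℕ, L.Perm A → R.Perm B →
        stackSort (L ++ m :: R) = stackSort L ++ stackSort R ++ [m] := by
      intro L R hL hR
      apply stackSort_split
      simpa only [List.mem_append, hL.mem_iff, hR.mem_iff] using hm
    -- With only one nonempty block, the maximum may stand at either end of its preimage.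
    have two : ∀ C : List ℕ, SortedWord C → C ≠ [] → A ++ B = C → A = [] ∨ B = [] →
        ∃ σ τ : List ℕ, σ ≠ τ ∧ σ.Perm (C ++ [m]) ∧ τ.Perm (C ++ [m]) ∧
      stackSort σ = C ++ [m] ∧ stackSort τ = C ++ [m] := by
      rintro C hC hC0 rfl h
      obtain ⟨σ, pσ, eσ⟩ := hC.exists_stackSort_eq
      have hσ : ∀ x ∈ σ, x < m := fun x hx => hm x (pσ.mem_iff.1 hx)
      refine ⟨[] ++ m :: σ, σ ++ [m], append_cons_ne ?_ fun h => lt_irrefl _ (hσ m h), ?_, ?_, ?_, ?_⟩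
      · rintro rfl
        exact hC0 (List.nil_perm.1 pσ)
      · exact (List.perm_append_comm (l₁ := [m])).trans (pσ.append_right [m])
      · exact pσ.append_right [m]
      · rw [stackSort_split (by simpa using hσ)]; simp [eσ]
      · rw [stackSort_split (by simpa using hσ)]; simp [eσ]
    rcases eq_or_ne A [] with rfl | hA0
    · rcases eq_or_ne B [] with rfl | hB0
      · exact .inl (.single m)
      · exact .inr (two B sB hB0 (by simp) (.inl rfl))
    rcases eq_or_ne B [] with rfl | hB0
    · right
      simpa using two A sA hA0 (by simp) (.inr rfl)
    have hn' := List.nodup_append.1 (List.nodup_append.1 hn).1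
    obtain ⟨L, pL, eL⟩ := sA.exists_stackSort_eq
    obtain ⟨R, pR, eR⟩ := sB.exists_stackSort_eq
    rcases hA hA0 hn'.1 with tA | ⟨σ, τ, hne, pσ, pτ, eσ, eτ⟩
    swap
    · refine .inr ⟨σ ++ m :: R, τ ++ m :: R, by simpa using hne, perm _ _ pσ pR, perm _ _ pτ pR,
        ?_, ?_⟩
      · rw [srt _ _ pσ pR, eσ, eR]
      · rw [srt _ _ pτ pR, eτ, eR]
    rcases hB hB0 hn'.2.1 with tB | ⟨σ, τ, hne, pσ, pτ, eσ, eτ⟩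
    swap
    · refine .inr ⟨L ++ m :: σ, L ++ m :: τ, by simpa using hne, perm _ _ pL pσ, perm _ _ pL pτ,
        ?_, ?_⟩
      · rw [srt _ _ pL pσ, eσ, eL]
      · rw [srt _ _ pL pτ, eτ, eL]
    by_cases hd : Drop A B
    · exact .inl (.node tA tB hd hm)
    right
    have sAB := sA.append_tightWord hA0 tB hd fun a ha hb => hn'.2.2 a ha a hb rfl
    obtain ⟨σ, pσ, eσ⟩ := sAB.exists_stackSort_eq
    refine ⟨L ++ m :: R, σ ++ [m], append_cons_ne ?_ fun h => lt_irrefl _ (hmB m (pR.mem_iff.1 h)),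
      perm _ _ pL pR, pσ.append_right [m], ?_, ?_⟩
    · rintro rfl
      exact hB0 (List.nil_perm.1 pR)
    · rw [srt _ _ pL pR, eL, eR]
    · rw [stackSort_split (by simpa only [List.append_nil, pσ.mem_iff] using hm)]
      simp [eσ]

theorem isSorted_iff {w : List ℕ} (hw : IsPermutation w) : IsSorted w ↔ SortedWord w := by
  rw [IsSorted, fertility, Set.encard_pos]
  constructor
  · rintro ⟨σ, hσ, rfl⟩
    exact (stackSort_perm_and_sortedWord hσ.1).2
  · intro h
    obtain ⟨σ, p, e⟩ := h.exists_stackSort_eq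
    exact ⟨σ, ⟨p.nodup_iff.2 hw.1, fun x hx => hw.2 x (p.mem_iff.1 hx)⟩, e⟩

theorem isUniquelySorted_iff {w : List ℕ} (hw : IsPermutation w) (h0 : w ≠ []) :
    IsUniquelySorted w ↔ TightWord w := by
  have perm : ∀ σ : List ℕ, σ.Perm w → IsPermutation σ := fun σ p =>
    ⟨p.nodup_iff.2 hw.1, fun x hx => hw.2 x (p.mem_iff.1 hx)⟩
  rw [IsUniquelySorted, fertility, Set.encard_eq_one]
  constructor
  · rintro ⟨ρ, hρ⟩
    have h : ρ ∈ {σ : List ℕ | IsPermutation σ ∧ stackSort σ = w} := by rw [hρ]; rfl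
    have hs : SortedWord w := h.2 ▸ (stackSort_perm_and_sortedWord h.1.1).2
    rcases hs.tightWord_or_exists_ne h0 hw.1 with ht | ⟨σ, τ, hne, pσ, pτ, eσ, eτ⟩
    · exact ht
    · have h1 : σ ∈ {σ : List ℕ | IsPermutation σ ∧ stackSort σ = w} := ⟨perm _ pσ, eσ⟩
      have h2 : τ ∈ {σ : List ℕ | IsPermutation σ ∧ stackSort σ = w} := ⟨perm _ pτ, eτ⟩
      rw [hρ] at h1 h2
      exact absurd (h1.trans h2.symm) hne
  · intro ht
    obtain ⟨σ, p, e⟩ := ht.sortedWord.exists_stackSort_eq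
    refine ⟨σ, Set.eq_singleton_iff_unique_mem.2 ⟨⟨perm _ p, e⟩, ?_⟩⟩
    rintro τ ⟨hτ, eτ⟩
    exact ht.stackSort_injective hτ.1 (perm _ p).1 eτ e

/-! ### Binary trees and their two reading words -/

/-- Plane binary trees. -/
inductive BinTree
  | nil : BinTree
  | node (l r : BinTree) : BinTree
  deriving DecidableEq

namespace BinTree

/-- The number of nodes. -/
def size : BinTree → ℕ
  | nil => 0
  | node l r => l.size + r.size + 1

/-- The number of left edges. -/
def lefts : BinTree → ℕ
  | nil => 0
  | node l r => (if l = nil then 0 else l.lefts + 1) + r.lefts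

/-- The number of right edges. -/
def rights : BinTree → ℕ
  | nil => 0
  | node l r => l.rights + if r = nil then 0 else r.rights + 1

/-- The nodes of a tree, labelled in inorder from `o + 1` on, in postorder. -/
def post (o : ℕ) : BinTree → List ℕ
  | nil => []
  | node l r => l.post o ++ r.post (o + l.size + 1) ++ [o + l.size + 1]

/-- The nodes of a tree, labelled in inorder from `o + 1` on, in the order in which each node comes
after its right subtree, followed by its left subtree. -/
def anti (o : ℕ) : BinTree → List ℕ
  | nil => []
  | node l r => r.anti (o + l.size + 1) ++ l.anti o ++ [o + l.size + 1]

/-- Each nonempty left subtree has more right edges than left edges. -/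
def LeftHeavy : BinTree → Prop
  | nil => True
  | node l r => l.LeftHeavy ∧ r.LeftHeavy ∧ (l ≠ nil → l.lefts < l.rights)

@[simp] theorem size_eq_zero {t : BinTree} : t.size = 0 ↔ t = nil := by
  cases t <;> simp [size]

theorem size_eq {t : BinTree} (ht : t ≠ nil) : t.size = t.lefts + t.rights + 1 := by
  induction t with
  | nil => exact absurd rfl ht
  | node l r hl hr =>
    rcases eq_or_ne l nil with rfl | hl0 <;> rcases eq_or_ne r nil with rfl | hr0 <;>
      simp_all [size, lefts, rights] <;> omega

theorem range'_split (o a b : ℕ) :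
    List.range' (o + 1) (a + b + 1) =
      List.range' (o + 1) a ++ (o + a + 1) :: List.range' (o + a + 1 + 1) b := by
  rw [add_assoc a b 1, ← List.range'_append_1, List.range'_succ, add_right_comm o 1 a]

theorem post_perm (t : BinTree) (o : ℕ) : (t.post o).Perm (List.range' (o + 1) t.size) := by
  induction t generalizing o with
  | nil => simp [post, size]
  | node l r hl hr =>
    rw [post, size, range'_split, List.append_assoc]
    exact (hl o).append (List.perm_append_comm.trans ((hr _).cons _))

theorem anti_perm (t : BinTree) (o : ℕ) : (t.anti o).Perm (List.range' (o + 1) t.size) := by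
  induction t generalizing o with
  | nil => simp [anti, size]
  | node l r hl hr =>
    rw [anti, size, range'_split, List.append_assoc]
    refine List.perm_append_comm.trans ?_
    rw [List.append_assoc]
    exact (hl o).append ((hr _).cons _)

theorem mem_post {t : BinTree} {o x : ℕ} : x ∈ t.post o ↔ o < x ∧ x ≤ o + t.size := by
  rw [(post_perm t o).mem_iff, List.mem_range'_1]
  omega

theorem mem_anti {t : BinTree} {o x : ℕ} : x ∈ t.anti o ↔ o < x ∧ x ≤ o + t.size := by
  rw [(anti_perm t o).mem_iff, List.mem_range'_1]
  omega

@[simp] theorem length_post (t : BinTree) (o : ℕ) : (t.post o).length = t.size := by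
  rw [(post_perm t o).length_eq, List.length_range']

@[simp] theorem length_anti (t : BinTree) (o : ℕ) : (t.anti o).length = t.size := by
  rw [(anti_perm t o).length_eq, List.length_range']

theorem post_ne_nil {t : BinTree} (ht : t ≠ nil) (o : ℕ) : t.post o ≠ [] := by
  rwa [ne_eq, ← List.length_eq_zero_iff, length_post, size_eq_zero]

theorem anti_ne_nil {t : BinTree} (ht : t ≠ nil) (o : ℕ) : t.anti o ≠ [] := by
  rwa [ne_eq, ← List.length_eq_zero_iff, length_anti, size_eq_zero]

/-- Inorder labels put the right subtree above its root and the left subtree below, so only a right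
edge yields a descent. -/
theorem desCount_post (t : BinTree) (o : ℕ) : desCount (t.post o) = t.rights := by
  induction t generalizing o with
  | nil => simp [post, rights]
  | node l r hl hr =>
    rw [post, List.append_assoc, desCount_append, hl, if_neg (not_drop_of_forall ?_),
      desCount_append, hr, rights]
    · rcases eq_or_ne r nil with rfl | hr0
      · simp [post, rights]
      · rw [if_pos (Drop.of_forall (post_ne_nil hr0 _) (by simp) ?_), if_neg hr0]
        · simp
        · simp only [mem_post, List.mem_singleton]; omega
    · simp only [List.mem_append, mem_post, List.mem_singleton]; omega

theorem desCount_anti (t : BinTree) (o : ℕ) : desCount (t.anti o) = t.rights := by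
  induction t generalizing o with
  | nil => simp [anti, rights]
  | node l r hl hr =>
    rw [anti, List.append_assoc, desCount_append, hr, desCount_concat_of_lt, hl, rights]
    · rcases eq_or_ne r nil with rfl | hr0
      · simp [anti, rights]
      · rw [if_pos (Drop.of_forall (anti_ne_nil hr0 _) (by simp) ?_), if_neg hr0]
        · omega
        · simp only [List.mem_append, mem_anti, List.mem_singleton]; omega
    · simp only [mem_anti]; omega

end BinTree

/-! ### Concatenations of tight words -/

/-- The concatenations of `j + 1` tight words with a descent at each junction. -/
inductive TightBlocks : ℕ → List ℕ → Prop
  | one {w : List ℕ} : TightWord w → TightBlocks 0 w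
  | cons {A w : List ℕ} {j : ℕ} : TightWord A → TightBlocks j w → Drop A w →
      TightBlocks (j + 1) (A ++ w)

theorem TightBlocks.ne_nil {j : ℕ} {w : List ℕ} (h : TightBlocks j w) : w ≠ [] := by
  cases h with
  | one h => exact h.ne_nil
  | cons h _ _ => simp [h.ne_nil]

theorem TightBlocks.tightWord {w : List ℕ} (h : TightBlocks 0 w) : TightWord w := by
  cases h; assumption

theorem TightBlocks.append {i j : ℕ} {v w : List ℕ} (hv : TightBlocks i v) (hw : TightBlocks j w)
    (hd : Drop v w) : TightBlocks (i + j + 1) (v ++ w) := by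
  induction hv with
  | one h => simpa using TightBlocks.cons h hw hd
  | @cons A v i hA hv hd' ih =>
    rw [drop_append_left hv.ne_nil] at hd
    rw [List.append_assoc, show i + 1 + j + 1 = (i + j + 1) + 1 by omega]
    exact .cons hA (ih hd) (by rwa [drop_append_right hv.ne_nil])

/-- The first leaf of `C` serves as the maximum that closes up `A ++ B`. -/
theorem TightWord.append_of_lt {A B C : List ℕ} (hA : TightWord A) (hB : TightWord B)
    (hC : TightWord C) (hd : Drop A B) (h : ∀ x ∈ A ++ B, ∀ y ∈ C, x < y) :
    TightWord (A ++ B ++ C) := by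
  induction hC with
  | single m => exact .node hA hB hd fun x hx => h x hx m (by simp)
  | @node C₁ C₂ m h₁ h₂ hd' hm ih₁ _ =>
    have := TightWord.node (m := m) (ih₁ fun x hx y hy => h x hx y (by simp [hy])) h₂
      (by rwa [drop_append_left h₁.ne_nil]) (by
        intro x hx
        rw [List.append_assoc, List.mem_append] at hx
        rcases hx with hx | hx
        · exact h x hx m (by simp)
        · exact hm x hx)
    simpa using this

theorem TightBlocks.append_tightWord_of_lt {j : ℕ} {w C : List ℕ} (hw : TightBlocks (j + 1) w)
    (hC : TightWord C) (h : ∀ x ∈ w, ∀ y ∈ C, x < y) : TightBlocks j (w ++ C) := by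
  induction j generalizing w with
  | zero =>
    cases hw with
    | cons hA hB hd => exact .one (hA.append_of_lt hB.tightWord hC hd h)
  | succ j ih =>
    cases hw with
    | cons hA hB hd =>
      rw [List.append_assoc]
      exact .cons hA (ih hB fun x hx => h x (by simp [hx])) (by rwa [drop_append_right hB.ne_nil])

/-- Only the first block of `C` is needed: it absorbs the last two blocks of `w`, so one junction
disappears. -/
theorem TightBlocks.append_of_lt {i j : ℕ} {w C : List ℕ} (hw : TightBlocks (j + 1) w)
    (hC : TightBlocks i C) (h : ∀ x ∈ w, ∀ y ∈ C, x < y) : TightBlocks (i + j) (w ++ C) := by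
  cases hC with
  | one hC => simpa using hw.append_tightWord_of_lt hC h
  | @cons A C i hA hC hd =>
    have := (hw.append_tightWord_of_lt hA fun x hx y hy => h x hx y (by simp [hy])).append hC
      (by rwa [drop_append_left hA.ne_nil])
    rw [← List.append_assoc, show i + 1 + j = j + i + 1 by omega]
    exact this

namespace BinTree

/-- The number of junctions is the excess of right over left edges. Left-heaviness guarantees two
blocks in `l.anti` for the root to absorb; the word of `r` then contributes its own blocks and one
more junction. -/
theorem LeftHeavy.tightBlocks_anti {t : BinTree} (h : t.LeftHeavy) (ht : t ≠ nil) (o : ℕ) :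
    ∃ j, j + t.lefts = t.rights ∧ TightBlocks j (t.anti o) := by
  induction t generalizing o with
  | nil => exact absurd rfl ht
  | node l r hl hr =>
    obtain ⟨j, ej, hj⟩ : ∃ j, j + (if l = nil then 0 else l.lefts + 1) = l.rights ∧
        TightBlocks j (l.anti o ++ [o + l.size + 1]) := by
      rcases eq_or_ne l nil with rfl | hl0
      · exact ⟨0, rfl, .one (.single _)⟩
      · obtain ⟨j, ej, hj⟩ := hl h.1 hl0 o
        obtain ⟨j, rfl⟩ : ∃ i, j = i + 1 :=
          Nat.exists_eq_succ_of_ne_zero (by have := h.2.2 hl0; omega)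
        refine ⟨j, by rw [if_neg hl0]; omega, hj.append_tightWord_of_lt (.single _) ?_⟩
        simp only [mem_anti, List.mem_singleton]; omega
    rw [anti, lefts, rights, List.append_assoc]
    rcases eq_or_ne r nil with rfl | hr0
    · exact ⟨j, by simpa [lefts] using ej, by simpa [anti] using hj⟩
    · obtain ⟨i, ei, hi⟩ := hr h.2.1 hr0 (o + l.size + 1)
      refine ⟨i + j + 1, by rw [if_neg hr0]; omega, hi.append hj ?_⟩
      refine Drop.of_forall hi.ne_nil hj.ne_nil ?_
      simp only [List.mem_append, mem_anti, List.mem_singleton]; omega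

/-- Here the root forms a block of its own after the right subtree, and the two last blocks of the
left subtree are absorbed by what follows, whose letters are all larger. -/
theorem LeftHeavy.tightBlocks_post {t : BinTree} (h : t.LeftHeavy) (ht : t ≠ nil) (o : ℕ) :
    ∃ j, j + t.lefts = t.rights ∧ TightBlocks j (t.post o) := by
  induction t generalizing o with
  | nil => exact absurd rfl ht
  | node l r hl hr =>
    obtain ⟨i, ei, hi⟩ : ∃ i, i + r.lefts = (if r = nil then 0 else r.rights + 1) ∧
        TightBlocks i (r.post (o + l.size + 1) ++ [o + l.size + 1]) := by
      rcases eq_or_ne r nil with rfl | hr0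
      · exact ⟨0, rfl, .one (.single _)⟩
      · obtain ⟨i, ei, hi⟩ := hr h.2.1 hr0 (o + l.size + 1)
        refine ⟨i + 1, by rw [if_neg hr0]; omega, hi.append (.one (.single _)) ?_⟩
        refine Drop.of_forall hi.ne_nil (by simp) ?_
        simp only [mem_post, List.mem_singleton]; omega
    rw [post, lefts, rights, List.append_assoc]
    rcases eq_or_ne l nil with rfl | hl0
    · exact ⟨i, by simpa [rights] using ei, by simpa [post] using hi⟩
    · obtain ⟨j, ej, hj⟩ := hl h.1 hl0 o
      obtain ⟨j, rfl⟩ : ∃ i, j = i + 1 :=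
        Nat.exists_eq_succ_of_ne_zero (by have := h.2.2 hl0; omega)
      refine ⟨i + j, by rw [if_neg hl0]; omega, hj.append_of_lt hi ?_⟩
      simp only [List.mem_append, mem_post, List.mem_singleton]; omega

theorem LeftHeavy.tightWord_anti {t : BinTree} (h : t.LeftHeavy) (ht : t ≠ nil)
    (he : t.rights ≤ t.lefts) (o : ℕ) : TightWord (t.anti o) := by
  obtain ⟨j, ej, hj⟩ := h.tightBlocks_anti ht o
  obtain rfl : j = 0 := by omega
  exact hj.tightWord

theorem LeftHeavy.tightWord_post {t : BinTree} (h : t.LeftHeavy) (ht : t ≠ nil)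
    (he : t.rights ≤ t.lefts) (o : ℕ) : TightWord (t.post o) := by
  obtain ⟨j, ej, hj⟩ := h.tightBlocks_post ht o
  obtain rfl : j = 0 := by omega
  exact hj.tightWord

end BinTree

/-- An ascent of a tight word ends the part of the word that the letter `p` closes up. -/
theorem TightWord.exists_of_ascent {w X Z : List ℕ} {p : ℕ} (hw : TightWord w)
    (e : w = X ++ p :: Z) (hX : X ≠ []) (hp : ¬ Drop X [p]) :
    ∃ X' A B, X = X' ++ (A ++ B) ∧ TightWord A ∧ TightWord B ∧ Drop A B ∧
      ∀ x ∈ A ++ B, x < p := by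
  induction hw generalizing X Z with
  | single x =>
    obtain ⟨a, X, rfl⟩ := List.exists_cons_of_ne_nil hX
    simp at e
  | @node A B m hA hB hd hm ihA ihB =>
    rcases List.eq_nil_or_concat Z with rfl | ⟨Z, z, rfl⟩
    · obtain ⟨e1, e2⟩ := List.append_inj' e rfl
      obtain rfl : m = p := by simpa using e2
      exact ⟨[], A, B, e1.symm, hA, hB, hd, hm⟩
    · have e' : A ++ B ++ [m] = (X ++ p :: Z) ++ [z] := by simpa using e
      obtain ⟨e, -⟩ := List.append_inj' e' rfl
      have hd' : Drop A (p :: Z) ↔ Drop A [p] := drop_append_right (B := [p]) (by simp) A Z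
      -- The letter `p` lies in `B` or in `A`. It is not the first letter of `B`, since a descent
      -- precedes that one.
      rcases List.append_eq_append_iff.1 e with ⟨C, rfl, rfl⟩ | ⟨C, rfl, h⟩
      · rcases eq_or_ne C [] with rfl | hC
        · simp only [List.append_nil, List.nil_append] at hp hd
          exact absurd (hd'.1 hd) hp
        · rw [drop_append_left hC] at hp
          obtain ⟨X', A', B', rfl, h⟩ := ihB rfl hC hp
          exact ⟨A ++ X', A', B', by simp, h⟩
      · rcases C with _ | ⟨c, C⟩
        · rw [List.nil_append] at h
          rw [← h, List.append_nil] at hd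
          exact absurd ((drop_append_right (B := [p]) (by simp) X Z).1 hd) hp
        · obtain ⟨rfl, rfl⟩ := List.cons_eq_cons.1 h
          exact ihA rfl hX hp

/-! ### Left-heaviness and tightness of `anti` words -/

namespace BinTree

/-- If a left subtree had too few right edges, its word would be tight by itself. But the root after
it is an ascent, hence closes up some `A ++ B` inside that word, and a tight word cannot end in two
such blocks. The statement is about factors of a tight word so that induction reaches the subtrees.
-/
theorem leftHeavy_of_tightWord {t : BinTree} {o : ℕ} {X Z : List ℕ}
    (hw : TightWord (X ++ t.anti o ++ Z)) (hX : ∀ x ∈ X.getLast?, o + t.size < x) :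
    t.LeftHeavy := by
  induction t generalizing o X Z with
  | nil => trivial
  | node l r hl hr =>
    simp only [anti, size] at hw hX
    have hXr : ∀ x ∈ (X ++ r.anti (o + l.size + 1)).getLast?, o + l.size < x := by
      intro x hx
      rw [List.getLast?_append] at hx
      rcases h : (r.anti (o + l.size + 1)).getLast? with _ | y
      · rw [h, Option.none_or] at hx
        have := hX x hx
        omega
      · rw [h] at hx
        obtain rfl : y = x := by simpa using hx
        have := mem_anti.1 (List.mem_of_getLast? h)
        omega
    have h1 : r.LeftHeavy := hr (o := o + l.size + 1) (X := X)
      (Z := l.anti o ++ [o + l.size + 1] ++ Z) (by simpa using hw) fun x hx => by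
        have := hX x hx
        omega
    have h2 : l.LeftHeavy := hl (o := o) (X := X ++ r.anti (o + l.size + 1))
      (Z := [o + l.size + 1] ++ Z) (by simpa using hw) hXr
    refine ⟨h2, h1, fun hl0 => ?_⟩
    by_contra hle
    have ht := h2.tightWord_anti hl0 (not_lt.1 hle) o
    obtain ⟨X', A, B, e, hA, hB, hd, hm⟩ := hw.exists_of_ascent
      (X := X ++ r.anti (o + l.size + 1) ++ l.anti o) (p := o + l.size + 1) (Z := Z) (by simp)
      (by simp [anti_ne_nil hl0]) (by
        rw [drop_append_left (anti_ne_nil hl0 o)]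
        refine not_drop_of_forall ?_
        simp only [mem_anti, List.mem_singleton]; omega)
    -- The letter before `l.anti o` is at least `o + l.size + 1`, the root, so `A ++ B` does not
    -- extend that far.
    obtain ⟨C, hC⟩ : ∃ C, l.anti o = C ++ (A ++ B) := by
      rcases List.append_eq_append_iff.1 e with ⟨C, h, h'⟩ | ⟨C, h, h'⟩
      · exact ⟨C, h'⟩
      · rcases List.eq_nil_or_concat C with rfl | ⟨C, c, rfl⟩
        · exact ⟨[], h'.symm⟩
        · exfalso
          have h3 := hXr c (by rw [h]; simp)
          have h4 := hm c (by rw [h']; simp)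
          omega
    -- Removing the tight end `B` and the descent before it leaves `C ++ A` one letter longer than a
    -- prefix may be.
    have h5 := ht.prefix_length_le (C := C ++ A) (by simp [hA.ne_nil]) (by rw [hC]; simp)
    have h6 := ht.length_eq
    have h7 := hB.length_eq
    rw [hC, ← List.append_assoc, desCount_append, if_pos (by rwa [drop_append_left hA.ne_nil]),
      List.length_append] at h6
    omega

theorem tightWord_anti_iff {t : BinTree} (ht : t ≠ nil) (he : t.lefts = t.rights) :
    TightWord (t.anti 0) ↔ t.LeftHeavy :=
  ⟨fun h => leftHeavy_of_tightWord (X := []) (Z := []) (by simpa using h) (by simp),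
    fun h => h.tightWord_anti ht he.ge 0⟩

theorem tightWord_anti_iff_sortedWord {t : BinTree} (ht : t ≠ nil) (he : t.lefts = t.rights) :
    TightWord (t.anti 0) ↔ SortedWord (t.anti 0) := by
  refine ⟨TightWord.sortedWord, fun h => h.tightWord ?_⟩
  rw [desCount_anti, length_anti, size_eq ht]
  omega

theorem lefts_eq_rights_of_anti {t : BinTree} (h : TightWord (t.anti 0)) :
    t.lefts = t.rights := by
  have h0 : t ≠ nil := by rintro rfl; exact h.ne_nil rfl
  have := h.length_eq
  rw [desCount_anti, length_anti, size_eq h0] at this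
  omega

theorem lefts_eq_rights_of_post {t : BinTree} (h : TightWord (t.post 0)) :
    t.lefts = t.rights := by
  have h0 : t ≠ nil := by rintro rfl; exact h.ne_nil rfl
  have := h.length_eq
  rw [desCount_post, length_post, size_eq h0] at this
  omega

end BinTree

/-! ### Words in `U` and `D` -/

/-- The path `w`, started at height `h`, never goes below height `0`. -/
def StaysNonneg : List DyckStep → ℕ → Prop
  | [], _ => True
  | U :: w, h => StaysNonneg w (h + 1)
  | D :: _, 0 => False
  | D :: w, h + 1 => StaysNonneg w h

theorem StaysNonneg.mono {w : List DyckStep} {h h' : ℕ} (hw : StaysNonneg w h) (hh : h ≤ h') :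
    StaysNonneg w h' := by
  induction w generalizing h h' with
  | nil => trivial
  | cons s w ih =>
    cases s with
    | U => exact ih (h := h + 1) hw (by omega)
    | D =>
      obtain _ | h := h
      · exact hw.elim
      obtain ⟨h', rfl⟩ : ∃ i, h' = i + 1 := Nat.exists_eq_succ_of_ne_zero (by omega)
      exact ih (h := h) hw (by omega)

theorem StaysNonneg.append {v w : List DyckStep} {h h' : ℕ} (hv : StaysNonneg v h)
    (hw : StaysNonneg w h') (e : h + v.count U = h' + v.count D) : StaysNonneg (v ++ w) h := by
  induction v generalizing h with
  | nil =>
    obtain rfl : h = h' := by simpa using e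
    exact hw
  | cons s v ih =>
    cases s with
    | U => exact ih (h := h + 1) hv (by simp at e; omega)
    | D =>
      obtain _ | h := h
      · exact hv.elim
      exact ih (h := h) hv (by simp at e; omega)

theorem StaysNonneg.count_take_le {w : List DyckStep} {h : ℕ} (hw : StaysNonneg w h) (i : ℕ) :
    (w.take i).count D ≤ (w.take i).count U + h := by
  induction w generalizing h i with
  | nil => simp
  | cons s w ih =>
    obtain _ | i := i
    · simp
    cases s with
    | U =>
      have := ih (h := h + 1) hw i
      simp
      omega
    | D =>
      obtain _ | h := h
      · exact hw.elim
      have := ih (h := h) hw i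
      simp
      omega

theorem StaysNonneg.mem_dyckPaths {w : List DyckStep} (hw : StaysNonneg w 0) {k : ℕ}
    (hU : w.count U = k) (hD : w.count D = k) : w ∈ DyckPaths k :=
  ⟨⟨w, by omega, fun i => by simpa using hw.count_take_le i⟩, hU, rfl⟩

theorem count_le_of_suffix {k : ℕ} {w s : List DyckStep} (hw : w ∈ DyckPaths k) (hs : s <:+ w) :
    s.count U ≤ s.count D := by
  obtain ⟨p, -, rfl⟩ := hw
  obtain ⟨q, hq⟩ := hs
  have h1 := p.count_U_eq_count_D
  have h2 := p.count_D_le_count_U q.length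
  rw [← hq, List.take_left] at h2
  rw [← hq, List.count_append, List.count_append] at h1
  omega

theorem count_of_mem_dyckPaths {k : ℕ} {w : List DyckStep} (hw : w ∈ DyckPaths k) :
    w.count U = k ∧ w.count D = k := by
  obtain ⟨p, rfl, rfl⟩ := hw
  exact ⟨rfl, p.count_U_eq_count_D.symm⟩

/-! ### Matching down steps -/

/-- The number of up steps of `w` before the path, started at height `h`, goes below height `0`. -/
def upsToReturn : List DyckStep → ℕ → ℕ
  | [], _ => 0
  | U :: w, h => upsToReturn w (h + 1) + 1
  | D :: _, 0 => 0
  | D :: w, h + 1 => upsToReturn w h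

/-- The numbers of up steps between each up step of `w` and the matching down step. -/
def returns : List DyckStep → List ℕ
  | [] => []
  | U :: w => upsToReturn w 0 :: returns w
  | D :: w => returns w

theorem length_returns (w : List DyckStep) : (returns w).length = w.count U := by
  induction w with
  | nil => rfl
  | cons s w ih => cases s <;> simp [returns, ih]

theorem upsToReturn_cons_le {v w : List DyckStep} (h : ∀ i, upsToReturn v i ≤ upsToReturn w i)
    (s : DyckStep) (i : ℕ) : upsToReturn (s :: v) i ≤ upsToReturn (s :: w) i := by
  cases s with
  | U => simpa [upsToReturn] using h (i + 1)
  | D => cases i <;> simp [upsToReturn, h]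

/-- Delaying a down step raises the path in between, so the return comes no earlier. -/
theorem upsToReturn_move (v w : List DyckStep) (i : ℕ) :
    upsToReturn (D :: (v ++ w)) i ≤ upsToReturn (v ++ D :: w) i := by
  induction v generalizing i with
  | nil => exact le_rfl
  | cons s v ih =>
    obtain _ | i := i
    · simp [upsToReturn]
    cases s with
    | U => simpa [upsToReturn] using ih (i + 2)
    | D => exact ih i

theorem StaysNonneg.move {v w : List DyckStep} {i : ℕ} (h : StaysNonneg (D :: (v ++ w)) i) :
    StaysNonneg (v ++ D :: w) i := by
  induction v generalizing i with
  | nil => exact h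
  | cons s v ih =>
    obtain _ | i := i
    · exact h.elim
    cases s with
    | U => exact ih (i := i + 2) h
    | D =>
      obtain _ | i := i
      · exact h.elim
      exact ih (i := i + 1) h

/-- The return happens inside `v`, so what follows is irrelevant. -/
theorem upsToReturn_append_of_lt {v : List DyckStep} {h : ℕ} (hv : v.count U + h < v.count D)
    (x y : List DyckStep) : upsToReturn (v ++ x) h = upsToReturn (v ++ y) h ∧
      upsToReturn (v ++ x) h ≤ v.count U := by
  induction v generalizing h with
  | nil => simp at hv
  | cons s v ih =>
    cases s with
    | U =>
      have := ih (h := h + 1) (by simp at hv; omega)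
      simpa [upsToReturn] using this
    | D =>
      obtain _ | h := h
      · simp [upsToReturn]
      have := ih (h := h) (by simp at hv; omega)
      simpa [upsToReturn] using this

/-! ### Longevities -/

/-- The number of down steps before the `(t + 1)`-st up step of `w`. -/
def downsBefore (w : List DyckStep) (t : ℕ) : ℕ :=
  ∑ i ∈ Finset.range (t + 1), (downRuns (U :: w)).getD i 0

theorem downsBefore_nil (t : ℕ) : downsBefore [] t = 0 := by
  rw [downsBefore, Finset.sum_range_succ']
  simp [downRuns]

theorem downsBefore_cons_D (w : List DyckStep) (t : ℕ) :
    downsBefore (D :: w) t = downsBefore w t + 1 := by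
  rw [downsBefore, downsBefore, Finset.sum_range_succ', Finset.sum_range_succ']
  simp [downRuns, add_assoc]

theorem downsBefore_cons_U_zero (w : List DyckStep) : downsBefore (U :: w) 0 = 0 := by
  simp [downsBefore, downRuns]

theorem downsBefore_cons_U_succ (w : List DyckStep) (t : ℕ) :
    downsBefore (U :: w) (t + 1) = downsBefore w t := by
  rw [downsBefore, downsBefore, Finset.sum_range_succ']
  simp [downRuns]

/-- The inequality `h + t < downsBefore w t` places the path below height `0` just before up step `t
+ 1`. This lemma and the next one show that `upsToReturn w h` is the least such `t`. -/
theorem not_lt_downsBefore (w : List DyckStep) (h t : ℕ) (ht : t < upsToReturn w h) :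
    ¬ h + t < downsBefore w t := by
  induction w generalizing h t with
  | nil => simp [downsBefore_nil]
  | cons s w ih =>
    cases s with
    | U =>
      obtain _ | t := t
      · simp [downsBefore_cons_U_zero]
      · have := ih (h + 1) t (by simpa [upsToReturn] using ht)
        rw [downsBefore_cons_U_succ]
        omega
    | D =>
      obtain _ | h := h
      · simp [upsToReturn] at ht
      · have := ih h t (by simpa [upsToReturn] using ht)
        rw [downsBefore_cons_D]
        omega

theorem lt_downsBefore_upsToReturn (w : List DyckStep) (h : ℕ) (hw : w.count U + h < w.count D) :
    h + upsToReturn w h < downsBefore w (upsToReturn w h) := by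
  induction w generalizing h with
  | nil => simp at hw
  | cons s w ih =>
    cases s with
    | U =>
      have := ih (h + 1) (by simp at hw; omega)
      rw [upsToReturn, downsBefore_cons_U_succ]
      omega
    | D =>
      rw [downsBefore_cons_D]
      obtain _ | h := h
      · simp [upsToReturn]
      · have := ih h (by simp at hw; omega)
        rw [upsToReturn]
        omega

theorem sum_Icc_pred (f : ℕ → ℕ) (j t : ℕ) :
    ∑ i ∈ Finset.Icc (j + 1) (j + 1 + t), f (i - 1) = ∑ i ∈ Finset.range (t + 1), f (j + i) := by
  rw [← Finset.Ico_add_one_right_eq_Icc, Finset.sum_Ico_eq_sum_range]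
  refine Finset.sum_congr (by congr 1; omega) fun i _ => ?_
  congr 1
  omega

theorem longevity_cons_U_one {w : List DyckStep} (hw : w.count U < w.count D) :
    longevity (U :: w) 1 = upsToReturn w 0 := by
  have key : ∀ t, ∑ i ∈ Finset.Icc 1 (1 + t), (downRuns (U :: w)).getD (i - 1) 0 =
      downsBefore w t := fun t => by
    simpa [downsBefore] using sum_Icc_pred (fun i => (downRuns (U :: w)).getD i 0) 0 t
  simp only [longevity, key]
  apply le_antisymm
  · exact Nat.sInf_le (by simpa using lt_downsBefore_upsToReturn w 0 (by simpa using hw))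
  · refine le_csInf ⟨_, (by simpa using lt_downsBefore_upsToReturn w 0 (by simpa using hw))⟩ ?_
    intro t ht
    by_contra hlt
    exact not_lt_downsBefore w 0 t (not_le.1 hlt) (by simpa using ht)

theorem longevity_cons_U_succ (w : List DyckStep) (j : ℕ) :
    longevity (U :: w) (j + 2) = longevity w (j + 1) := by
  have h1 := sum_Icc_pred (fun i => (downRuns (U :: w)).getD i 0) (j + 1)
  have h2 := sum_Icc_pred (fun i => (downRuns w).getD i 0) j
  simp only [add_assoc, Nat.reduceAdd] at h1 h2
  simp only [longevity, add_assoc, h1, h2]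
  simp only [downRuns, ← add_assoc, add_right_comm j 1, List.getD_cons_succ]

theorem longevity_cons_D (w : List DyckStep) (j : ℕ) : longevity (D :: w) j = longevity w j := rfl

/-- The suffix condition, applied to a suffix starting with an up step, ensures that this step is
matched, so the infimum is over a nonempty set. -/
theorem longevity_eq {w : List DyckStep} (hw : ∀ s, s <:+ w → s.count U ≤ s.count D) {j : ℕ}
    (hj : j < w.count U) : longevity w (j + 1) = (returns w).getD j 0 := by
  induction w generalizing j with
  | nil => simp at hj
  | cons s w ih =>
    have hw' : ∀ s, s <:+ w → s.count U ≤ s.count D := fun s hs =>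
      hw s (hs.trans (List.suffix_cons _ _))
    cases s with
    | U =>
      obtain _ | j := j
      · rw [longevity_cons_U_one (by simpa using hw _ (List.suffix_refl _))]
        simp [returns]
      · rw [longevity_cons_U_succ, ih hw' (by simpa using hj)]
        simp [returns]
    | D => rw [longevity_cons_D, ih hw' (by simpa using hj), returns]

theorem tamariLE_iff {k : ℕ} {v w : List DyckStep} (hv : v ∈ DyckPaths k) (hw : w ∈ DyckPaths k) :
    TamariLE k v w ↔ List.Forall₂ (· ≤ ·) (returns v) (returns w) := by
  have lv := (count_of_mem_dyckPaths hv).1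
  have lw := (count_of_mem_dyckPaths hw).1
  have ev := fun j => longevity_eq (fun s hs => count_le_of_suffix hv hs) (j := j)
  have ew := fun j => longevity_eq (fun s hs => count_le_of_suffix hw hs) (j := j)
  rw [List.forall₂_iff_get]
  have lv' := length_returns v
  have lw' := length_returns w
  simp only [length_returns, lv, lw, TamariLE, Finset.mem_Icc] at ev ew ⊢
  constructor
  · refine fun h => ⟨trivial, fun j hj hj' => ?_⟩
    have := h (j + 1) ⟨by omega, hj⟩
    rw [ev j hj, ew j hj'] at this
    rwa [List.getD_eq_getElem _ _ (by omega), List.getD_eq_getElem _ _ (by omega)] at this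
  · rintro ⟨-, h⟩ j ⟨h1, h2⟩
    obtain ⟨j, rfl⟩ := Nat.exists_eq_succ_of_ne_zero (by omega : j ≠ 0)
    have := h j h2 h2
    rw [Nat.succ_eq_add_one, ev j h2, ew j h2]
    rwa [List.getD_eq_getElem _ _ (by rw [length_returns]; omega),
      List.getD_eq_getElem _ _ (by rw [length_returns]; omega)]

/-! ### The two paths of a binary tree -/

namespace BinTree

/-- The edges of a tree, in the order of reversed postorder: `D` for right, `U` for left edges. -/
def edgePath : BinTree → List DyckStep
  | nil => []
  | node l r => (if r = nil then [] else D :: r.edgePath) ++ if l = nil then [] else U :: l.edgePath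

/-- The edges of a tree as they occur between consecutive nodes in reversed inorder: `D` for right,
`U` for left edges. -/
def canopy : BinTree → List DyckStep
  | nil => []
  | node l r => r.canopy ++ ((if r = nil then [] else [D]) ++ if l = nil then [] else U :: l.canopy)

theorem count_edgePath (t : BinTree) :
    t.edgePath.count U = t.lefts ∧ t.edgePath.count D = t.rights := by
  induction t with
  | nil => simp [edgePath, lefts, rights]
  | node l r hl hr =>
    simp only [edgePath, lefts, rights, List.count_append]
    split_ifs <;> simp_all [add_comm, lefts, rights]

theorem count_canopy (t : BinTree) :
    t.canopy.count U = t.lefts ∧ t.canopy.count D = t.rights := by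
  induction t with
  | nil => simp [canopy, lefts, rights]
  | node l r hl hr =>
    simp only [canopy, lefts, rights, List.count_append]
    split_ifs <;> simp_all [add_comm, lefts, rights]
    all_goals omega

theorem stepWord_post (t : BinTree) (o : ℕ) : stepWord (t.post o) = t.edgePath.reverse := by
  induction t generalizing o with
  | nil => rfl
  | node l r hl hr =>
    have h : stepWord (r.post (o + l.size + 1) ++ [o + l.size + 1]) =
        (if r = nil then [] else D :: r.edgePath).reverse := by
      rcases eq_or_ne r nil with rfl | hr0
      · rfl
      · rw [stepWord_append (post_ne_nil hr0 _) (by simp), if_pos, hr, if_neg hr0]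
        · simp [stepWord]
        · refine Drop.of_forall (post_ne_nil hr0 _) (by simp) ?_
          simp only [mem_post, List.mem_singleton]; omega
    rw [post, edgePath, List.append_assoc, List.reverse_append, ← h]
    rcases eq_or_ne l nil with rfl | hl0
    · rfl
    · rw [stepWord_append (post_ne_nil hl0 _) (by simp), if_neg, hl, if_neg hl0]
      · simp
      · refine not_drop_of_forall ?_
        simp only [List.mem_append, mem_post, List.mem_singleton]; omega

/-- The canopy only delays the down steps of `edgePath`; each right edge is one application of
`upsToReturn_move`. -/
theorem upsToReturn_edgePath_le (t : BinTree) (x : List DyckStep) (i : ℕ) :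
    upsToReturn (t.edgePath ++ x) i ≤ upsToReturn (t.canopy ++ x) i := by
  induction t generalizing x i with
  | nil => exact le_rfl
  | node l r hl hr =>
    have h : ∀ i, upsToReturn ((if l = nil then [] else U :: l.edgePath) ++ x) i ≤
        upsToReturn ((if l = nil then [] else U :: l.canopy) ++ x) i := by
      intro i
      split_ifs
      · exact le_rfl
      · exact upsToReturn_cons_le (hl x) U i
    rw [edgePath, canopy]
    rcases eq_or_ne r nil with rfl | h1
    · simpa only [canopy, if_true, List.nil_append] using h i
    · simp only [if_neg h1, List.append_assoc, List.cons_append, List.nil_append]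
      refine (upsToReturn_cons_le (hr _) D i).trans ((upsToReturn_move _ _ i).trans ?_)
      have : ∀ (v a b : List DyckStep), (∀ i, upsToReturn a i ≤ upsToReturn b i) →
          ∀ i, upsToReturn (v ++ a) i ≤ upsToReturn (v ++ b) i := by
        intro v a b hab
        induction v with
        | nil => exact hab
        | cons s v ih => exact upsToReturn_cons_le ih s
      exact this _ _ _ (upsToReturn_cons_le h D) i

/-- Delaying down steps keeps a path nonnegative. The tails `x`, `x'` carry the words of the
remaining tree through the induction. -/
theorem staysNonneg_canopy (t : BinTree) {x x' : List DyckStep} (hx : ∀ i, StaysNonneg x i → StaysNonneg x' i)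
    {i : ℕ} (h : StaysNonneg (t.edgePath ++ x) i) : StaysNonneg (t.canopy ++ x') i := by
  induction t generalizing x x' i with
  | nil => exact hx i h
  | node l r hl hr =>
    have hx₁ : ∀ i, StaysNonneg ((if l = nil then [] else U :: l.edgePath) ++ x) i →
        StaysNonneg ((if l = nil then [] else U :: l.canopy) ++ x') i := by
      intro i hi
      split_ifs at hi ⊢
      · exact hx i hi
      · exact hl hx (i := i + 1) hi
    rw [edgePath, List.append_assoc] at h
    rw [canopy]
    rcases eq_or_ne r nil with rfl | h1
    · simpa only [canopy, if_true, List.nil_append] using hx₁ i h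
    · rw [if_neg h1] at h ⊢
      obtain _ | i := i
      · exact h.elim
      have := hr hx₁ (i := i) h
      simpa only [List.append_assoc, List.cons_append, List.nil_append] using StaysNonneg.move (i := i + 1) this

/-! ### Left-heaviness as a comparison of returns -/

theorem LeftHeavy.lefts_le_rights {t : BinTree} (h : t.LeftHeavy) : t.lefts ≤ t.rights := by
  rcases eq_or_ne t nil with rfl | h0
  · rfl
  · obtain ⟨j, hj, -⟩ := h.tightBlocks_anti h0 0
    omega

/-- The edge path of a left-heavy tree is lowest at its end, so a nonnegative final height `h'`
excludes an earlier return. -/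
theorem LeftHeavy.upsToReturn_edgePath {t : BinTree} (ht : t.LeftHeavy) {h h' : ℕ}
    (e : h + t.lefts = h' + t.rights) (x : List DyckStep) :
    upsToReturn (t.edgePath ++ x) h = t.lefts + upsToReturn x h' := by
  induction t generalizing h h' x with
  | nil => simp_all [lefts, rights, edgePath]
  | node l r hl hr =>
    have hl' := ht.1.lefts_le_rights
    have hr' := ht.2.1.lefts_le_rights
    have hlr := ht.2.2
    have key : ∀ h, h + (if l = nil then 0 else l.lefts + 1) = h' + l.rights →
        upsToReturn ((if l = nil then [] else U :: l.edgePath) ++ x) h =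
          (if l = nil then 0 else l.lefts + 1) + upsToReturn x h' := by
      intro h e
      split_ifs at e ⊢ with h1
      · subst h1
        simp [rights] at e
        simp [e]
      · rw [List.cons_append, upsToReturn, hl ht.1 (h' := h') (by omega)]
        omega
    rw [edgePath, lefts, List.append_assoc]
    rw [lefts, rights] at e
    rcases eq_or_ne r nil with rfl | hr0
    · simp only [lefts, if_true] at e ⊢
      rw [List.nil_append, key h (by omega)]; omega
    · rw [if_neg hr0] at e ⊢
      obtain ⟨i, hi⟩ : ∃ i, i + (if l = nil then 0 else l.lefts + 1) = h' + l.rights := by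
        split_ifs with h1
        · exact ⟨_, rfl⟩
        · exact ⟨h' + l.rights - (l.lefts + 1), by have := hlr h1; omega⟩
      obtain ⟨h, rfl⟩ : ∃ j, h = j + 1 := Nat.exists_eq_succ_of_ne_zero (by omega)
      rw [List.cons_append, upsToReturn, hr ht.2.1 (h' := i) (by omega), key i hi]
      omega

/-- The up step of a left edge returns within the edge path of its left-heavy subtree, independently
of the tail, and the canopy can only delay this return. -/
theorem LeftHeavy.forall₂_returns {t : BinTree} (ht : t.LeftHeavy) {x x' : List DyckStep}
    (hx : List.Forall₂ (· ≤ ·) (returns x) (returns x')) :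
    List.Forall₂ (· ≤ ·) (returns (t.edgePath ++ x)) (returns (t.canopy ++ x')) := by
  induction t generalizing x x' with
  | nil => exact hx
  | node l r hl hr =>
    have h1 : List.Forall₂ (· ≤ ·) (returns ((if l = nil then [] else U :: l.edgePath) ++ x))
        (returns ((if l = nil then [] else U :: l.canopy) ++ x')) := by
      split_ifs with h0
      · exact hx
      · refine .cons ?_ (hl ht.1 hx)
        have := upsToReturn_append_of_lt (v := l.edgePath) (h := 0)
          (by rw [l.count_edgePath.1, l.count_edgePath.2]; exact ht.2.2 h0) x x'
        change upsToReturn (l.edgePath ++ x) 0 ≤ upsToReturn (l.canopy ++ x') 0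
        rw [this.1]
        exact l.upsToReturn_edgePath_le x' 0
    rw [edgePath, canopy, List.append_assoc, List.append_assoc]
    rcases eq_or_ne r nil with rfl | h2
    · simpa only [canopy, if_true, List.nil_append] using h1
    · rw [if_neg h2, if_neg h2]
      simpa only [List.append_assoc, List.cons_append, List.nil_append, returns] using hr ht.2.1 (x' := D :: _) h1

/-- Consider a left edge whose subtree has equally many left and right edges. Its up step is
unmatched in that subtree's edge path, so by `hs` the tail `x` is nonempty. Then `x` starts with the
up step of another left edge, while the canopy continues with the down step of a right edge. -/
theorem leftHeavy_of_forall₂_returns {t : BinTree} {x x' : List DyckStep}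
    (h : List.Forall₂ (· ≤ ·) (returns (t.edgePath ++ x)) (returns (t.canopy ++ x')))
    (hs : ∀ s, s <:+ t.edgePath ++ x → s.count U ≤ s.count D)
    (hx : x = [] ∨ ∃ y, x = U :: y) (hx' : (x = [] ∧ x' = []) ∨ ∃ y, x' = D :: y) :
    t.LeftHeavy ∧ List.Forall₂ (· ≤ ·) (returns x) (returns x') := by
  induction t generalizing x x' with
  | nil => exact ⟨trivial, h⟩
  | node l r hl hr =>
    obtain ⟨h1, h2, hs'⟩ : r.LeftHeavy ∧
        List.Forall₂ (· ≤ ·) (returns ((if l = nil then [] else U :: l.edgePath) ++ x))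
          (returns ((if l = nil then [] else U :: l.canopy) ++ x')) ∧
        ∀ s, s <:+ (if l = nil then [] else U :: l.edgePath) ++ x → s.count U ≤ s.count D := by
      rw [edgePath, canopy] at h
      rw [edgePath] at hs
      rcases eq_or_ne r nil with rfl | hr0
      · exact ⟨trivial, by simpa [canopy] using h, by simpa using hs⟩
      · simp only [if_neg hr0, List.append_assoc, List.cons_append, List.nil_append, returns] at h hs
        have := hr h (fun s h => hs s (h.trans (List.suffix_cons _ _))) (by
          split_ifs
          · exact hx
          · exact .inr ⟨_, rfl⟩) (.inr ⟨_, rfl⟩)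
        exact ⟨this.1, this.2, fun s h => hs s (h.trans
          ((List.suffix_append _ _).trans (List.suffix_cons _ _)))⟩
    rcases eq_or_ne l nil with rfl | hl0
    · exact ⟨⟨trivial, h1, fun h => absurd rfl h⟩, h2⟩
    rw [if_neg hl0, if_neg hl0] at h2
    rw [if_neg hl0] at hs'
    obtain ⟨h3, h4⟩ := List.forall₂_cons.1 h2
    have h5 := hl h4 (fun s h => hs' s (h.trans (List.suffix_cons _ _))) hx hx'
    refine ⟨⟨h5.1, h1, fun _ => ?_⟩, h5.2⟩
    by_contra hlt
    have he : l.lefts = l.rights := le_antisymm h5.1.lefts_le_rights (not_lt.1 hlt)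
    have cl := l.count_edgePath
    have cc := l.count_canopy
    rcases hx with rfl | ⟨y, rfl⟩
    · have := hs' _ (List.suffix_refl _)
      simp at this
      omega
    -- Along the edge path at least `l.lefts + 1` up steps precede the return; along the canopy the
    -- down step after it forces the return after at most `l.lefts`.
    · obtain ⟨y', rfl⟩ := hx'.resolve_left (by simp)
      have h6 := h5.1.upsToReturn_edgePath (h := 0) (h' := 0) (by omega) (U :: y)
      have h7 := (upsToReturn_append_of_lt (v := l.canopy ++ [D]) (h := 0)
        (by simp; omega) y' []).2
      simp only [List.append_assoc, List.singleton_append, List.count_append] at h7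
      rw [upsToReturn] at h6
      change upsToReturn (l.edgePath ++ U :: y) 0 ≤ upsToReturn (l.canopy ++ D :: y') 0 at h3
      simp at h7
      omega

end BinTree

/-- Read backwards, a node gives `U`, the steps of `B`, `D`, the steps of `A`: the first-return
decomposition of a Dyck path. -/
theorem TightWord.staysNonneg {w : List ℕ} (h : TightWord w) :
    StaysNonneg (stepWord w).reverse 0 := by
  have key : ∀ v, TightWord v → (stepWord v).count U = (stepWord v).count D := by
    intro v hv
    have h1 := hv.length_eq
    have h2 := length_stepWord v
    have h3 : (stepWord v).count U + (stepWord v).count D = (stepWord v).length := by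
      generalize stepWord v = l
      induction l with
      | nil => rfl
      | cons s l ih => cases s <;> simp <;> omega
    rw [desCount] at h1
    omega
  induction h with
  | single x => trivial
  | @node A B m hA hB hd hm ihA ihB =>
    rw [stepWord_append (by simp [hA.ne_nil]) (by simp),
      if_neg (not_drop_of_forall (by simpa using hm)), stepWord_append hA.ne_nil hB.ne_nil,
      if_pos hd]
    simp only [List.reverse_append, List.reverse_cons, List.append_assoc, stepWord,
      List.reverse_nil, List.nil_append, List.cons_append]
    change StaysNonneg _ 1
    exact (ihB.mono zero_le_one).append (h' := 1) (w := D :: _) ihA (by simp [key B hB])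

namespace BinTree

theorem edgePath_mem_dyckPaths {t : BinTree} (h : TightWord (t.post 0)) :
    t.edgePath ∈ DyckPaths t.lefts := by
  refine StaysNonneg.mem_dyckPaths ?_ t.count_edgePath.1 ?_
  · simpa [stepWord_post] using h.staysNonneg
  · rw [t.count_edgePath.2, lefts_eq_rights_of_post h]

theorem canopy_mem_dyckPaths {t : BinTree} (h : TightWord (t.post 0)) :
    t.canopy ∈ DyckPaths t.lefts := by
  refine StaysNonneg.mem_dyckPaths ?_ t.count_canopy.1 ?_
  · have := h.staysNonneg
    rw [stepWord_post, List.reverse_reverse] at this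
    simpa using t.staysNonneg_canopy (x := []) (x' := []) (fun _ h => h) (by simpa using this)
  · rw [t.count_canopy.2, lefts_eq_rights_of_post h]

theorem leftHeavy_iff_tamariLE {t : BinTree} {k : ℕ} (h : t.edgePath ∈ DyckPaths k)
    (h' : t.canopy ∈ DyckPaths k) : t.LeftHeavy ↔ TamariLE k t.edgePath t.canopy := by
  rw [tamariLE_iff h h']
  constructor
  · intro ht
    simpa using ht.forall₂_returns (x := []) (x' := []) .nil
  · intro hr
    exact (leftHeavy_of_forall₂_returns (x := []) (x' := []) (by simpa using hr)
      (by simpa using fun s hs => count_le_of_suffix h hs) (.inl rfl) (.inl ⟨rfl, rfl⟩)).1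

end BinTree

/-! ### Sums of down runs -/

/-- The word `U D^{γ_1} U D^{γ_2} ⋯`. -/
def runWord : List ℕ → List DyckStep
  | [] => []
  | a :: g => U :: (List.replicate a D ++ runWord g)

theorem runWord_append (g g' : List ℕ) : runWord (g ++ g') = runWord g ++ runWord g' := by
  induction g with
  | nil => rfl
  | cons a g ih => simp [runWord, ih]

theorem count_runWord (g : List ℕ) :
    (runWord g).count U = g.length ∧ (runWord g).count D = g.sum := by
  induction g with
  | nil => simp [runWord]
  | cons a g ih => simp [runWord, ih, List.count_replicate]

theorem eq_replicate_append_runWord (w : List DyckStep) :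
    w = List.replicate (w.takeWhile (· = D)).length D ++ runWord (downRuns w) := by
  induction w with
  | nil => rfl
  | cons s w ih =>
    cases s with
    | U => simpa [downRuns, runWord] using ih
    | D => simpa [downRuns, List.replicate_succ] using ih

theorem runWord_downRuns {k : ℕ} {w : List DyckStep} (hw : w ∈ DyckPaths k) :
    runWord (downRuns w) = w := by
  obtain ⟨p, -, rfl⟩ := hw
  rcases h : p.toList with _ | ⟨_ | _, w⟩
  · rfl
  · exact (eq_replicate_append_runWord (U :: w)).symm
  · have := p.count_D_le_count_U 1
    rw [h] at this
    simp at this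

/-- The number of down steps before the `(n + 1)`-st up step of a Dyck path. -/
def runSum (w : List DyckStep) (n : ℕ) : ℕ := ((downRuns w).take n).sum

theorem length_downRuns {k : ℕ} {w : List DyckStep} (hw : w ∈ DyckPaths k) :
    (downRuns w).length = k := by
  rw [← (count_runWord _).1, runWord_downRuns hw, (count_of_mem_dyckPaths hw).1]

theorem sum_downRuns {k : ℕ} {w : List DyckStep} (hw : w ∈ DyckPaths k) :
    (downRuns w).sum = k := by
  rw [← (count_runWord _).2, runWord_downRuns hw, (count_of_mem_dyckPaths hw).2]

theorem runSum_self {k : ℕ} {w : List DyckStep} (hw : w ∈ DyckPaths k) : runSum w k = k := by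
  rw [runSum, List.take_of_length_le (length_downRuns hw).le, sum_downRuns hw]

theorem runSum_le {k : ℕ} {w : List DyckStep} (hw : w ∈ DyckPaths k) (n : ℕ) :
    runSum w n ≤ n := by
  have h : runWord ((downRuns w).drop n) <:+ w := by
    conv_rhs => rw [← runWord_downRuns hw, ← List.take_append_drop n (downRuns w), runWord_append]
    exact List.suffix_append _ _
  have h1 := count_le_of_suffix hw h
  have h2 := List.sum_take_add_sum_drop (downRuns w) n
  rw [(count_runWord _).1, (count_runWord _).2, List.length_drop, length_downRuns hw] at h1
  rw [sum_downRuns hw] at h2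
  have : runSum w n = ((downRuns w).take n).sum := rfl
  omega

theorem runSum_mono (w : List DyckStep) : Monotone (runSum w) := by
  intro m n h
  exact (List.take_sublist_take_left h).sum_le_sum (by simp)

theorem sum_range_getD (g : List ℕ) (n : ℕ) :
    ∑ i ∈ Finset.range n, g.getD i 0 = (g.take n).sum := by
  induction g generalizing n with
  | nil => simp
  | cons a g ih =>
    obtain _ | n := n
    · simp
    · rw [Finset.sum_range_succ', List.take_succ_cons, List.sum_cons, ← ih, add_comm]
      simp

theorem longevity_eq_sInf (w : List DyckStep) (j : ℕ) :
    longevity w (j + 1) = sInf {t | runSum w j + t < runSum w (j + t + 1)} := by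
  have h := sum_Icc_pred (fun i => (downRuns w).getD i 0) j
  simp only [add_assoc] at h
  simp only [longevity, add_assoc, h]
  simp only [ runSum, ← sum_range_getD]
  congr 1
  ext t
  rw [Set.mem_ofPred_eq, Set.mem_ofPred_eq, Finset.sum_range_add _ j (t + 1)]
  omega

theorem runSum_le_of_lt_longevity {w : List DyckStep} {j t : ℕ} (h : t < longevity w (j + 1)) :
    runSum w (j + t + 1) ≤ runSum w j + t := by
  rw [longevity_eq_sInf] at h
  simpa using Nat.notMem_of_lt_sInf h

theorem le_longevity {k : ℕ} {w : List DyckStep} (hw : w ∈ DyckPaths k) {j m : ℕ} (hj : j < k)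
    (h : ∀ t < m, runSum w (j + t + 1) ≤ runSum w j + t) : m ≤ longevity w (j + 1) := by
  rw [longevity_eq_sInf]
  -- This `t` reaches the end of the path, so the set is nonempty.
  refine le_csInf ⟨k - 1 - j, ?_⟩ fun t ht => ?_
  · have := runSum_le hw j
    rw [Set.mem_ofPred_eq, show j + (k - 1 - j) + 1 = k by omega, runSum_self hw]
    omega
  · by_contra hlt
    exact absurd ht (not_lt.2 (h t (not_le.1 hlt)))

/-- The Tamari order is contained in the order of paths by height. -/
theorem TamariLE.runSum_le {k : ℕ} {v w : List DyckStep} (hv : v ∈ DyckPaths k)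
    (hw : w ∈ DyckPaths k) (h : TamariLE k v w) {j : ℕ} (hj : j ≤ k) :
    runSum w j ≤ runSum v j := by
  induction j using Nat.strong_induction_on with
  | _ j ih =>
    by_contra! hlt
    have hj0 : j ≠ 0 := by rintro rfl; simp [runSum] at hlt
    have hwj := CatalanIntervals.runSum_le hw j
    -- Take the last `i < j` at which `v`, before its up step `i + 1`, is at most as high as `w`
    -- before its up step `j + 1`. The index `0` qualifies because `w` is a Dyck path. By maximality
    -- the two heights are equal.
    obtain ⟨i, hi, hP, hmax⟩ : ∃ i, i < j ∧ i + runSum w j ≤ j + runSum v i ∧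
        ∀ m, i < m → m ≤ j → j + runSum v m < m + runSum w j := by
      refine ⟨Nat.findGreatest (fun i => i + runSum w j ≤ j + runSum v i) (j - 1), ?_, ?_, ?_⟩
      · have := Nat.findGreatest_le (P := fun i => i + runSum w j ≤ j + runSum v i) (j - 1)
        omega
      · exact Nat.findGreatest_spec (P := fun i => i + runSum w j ≤ j + runSum v i) (m := 0)
          (by omega) (by omega)
      · intro m hm hmj
        rcases eq_or_lt_of_le hmj with rfl | hmj
        · omega
        · exact not_le.1 (Nat.findGreatest_is_greatest
            (P := fun i => i + runSum w j ≤ j + runSum v i) (n := j - 1) hm (by omega))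
    have h1 := hmax (i + 1) (by omega) hi
    have h2 := runSum_mono v (Nat.le_succ i)
    rw [Nat.succ_eq_add_one] at h2
    -- From `i` to `j` the path `v` stays above its height at `i`. The order transfers this to `w`,
    -- which bounds `runSum w j` by `runSum w i + (j - i - 1)`; with `runSum w i ≤ runSum v i` this
    -- is one too small.
    have h3 : j - i ≤ longevity v (i + 1) := le_longevity hv (by omega) fun t ht => by
      have := hmax (i + t + 1) (by omega) (by omega)
      omega
    have h4 := h3.trans (h (i + 1) (Finset.mem_Icc.2 ⟨by omega, by omega⟩))
    have h5 := runSum_le_of_lt_longevity (w := w) (j := i) (t := j - i - 1) (by omega)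
    rw [show i + (j - i - 1) + 1 = j by omega] at h5
    have h6 := ih i hi (by omega)
    omega

/-! ### Trees from pairs of paths -/

namespace BinTree

/-- The path of a left edge and the subtree below it. -/
def leftEdge (l : BinTree) : List DyckStep := if l = nil then [] else U :: l.edgePath

/-- The canopy of a left edge and the subtree below it. -/
def leftCanopy (l : BinTree) : List DyckStep := if l = nil then [] else U :: l.canopy

theorem edgePath_node (l r : BinTree) :
    (node l r).edgePath = (if r = nil then [] else D :: r.edgePath) ++ l.leftEdge := rfl

theorem canopy_node (l r : BinTree) :
    (node l r).canopy = r.canopy ++ ((if r = nil then [] else [D]) ++ l.leftCanopy) := rfl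

@[simp] theorem leftEdge_nil : leftEdge nil = [] := rfl
@[simp] theorem leftCanopy_nil : leftCanopy nil = [] := rfl

theorem leftEdge_of_ne {l : BinTree} (hl : l ≠ nil) : l.leftEdge = U :: l.edgePath := if_neg hl
theorem leftCanopy_of_ne {l : BinTree} (hl : l ≠ nil) : l.leftCanopy = U :: l.canopy := if_neg hl

/-- The path of the left subtrees of a list of nodes. -/
def forestEdge : List BinTree → List DyckStep
  | [] => []
  | l :: f => l.leftEdge ++ forestEdge f

/-- The canopy of the left subtrees of a list of nodes, each of which has a right child. -/
def forestCanopy : List BinTree → List DyckStep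
  | [] => []
  | l :: f => D :: (l.leftCanopy ++ forestCanopy f)

theorem forestEdge_replicate_append (b : ℕ) (f : List BinTree) :
    forestEdge (List.replicate b nil ++ f) = forestEdge f := by
  induction b with
  | zero => rfl
  | succ b ih => simpa [List.replicate_succ, forestEdge] using ih

theorem forestCanopy_replicate_append (b : ℕ) (f : List BinTree) :
    forestCanopy (List.replicate b nil ++ f) = List.replicate b D ++ forestCanopy f := by
  induction b with
  | zero => rfl
  | succ b ih => simpa [List.replicate_succ, forestCanopy] using ih

/-- The nodes of `f` wait for a right child. Attaching the current tree to the first of them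
prepends one `D` to the edge path and leaves the joint canopy unchanged. -/
theorem exists_merge (a : ℕ) {t : BinTree} (ht : t ≠ nil) {f : List BinTree} (ha : a ≤ f.length) :
    ∃ (t' : BinTree) (f' : List BinTree), t' ≠ nil ∧ f'.length + a = f.length ∧
      t'.edgePath ++ forestEdge f' = List.replicate a D ++ (t.edgePath ++ forestEdge f) ∧
      t'.canopy ++ forestCanopy f' = t.canopy ++ forestCanopy f := by
  induction a with
  | zero => exact ⟨t, f, ht, rfl, rfl, rfl⟩
  | succ a ih =>
    obtain ⟨t', f', ht', hl, he, hc⟩ := ih (by omega)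
    obtain _ | ⟨l, f'⟩ := f'
    · simp at hl; omega
    · refine ⟨node l t', f', by simp, by simp at hl; omega, ?_, ?_⟩
      · rw [List.replicate_succ, List.cons_append, ← he, edgePath_node, if_neg ht']
        simp [forestEdge]
      · rw [← hc, canopy_node, if_neg ht']
        simp [forestCanopy]

/-- The runs are processed from the right. A pair of runs `a`, `b` creates `b` nodes without left
child, performs `a` attachments and hangs the result on a left edge. The number of waiting nodes is
the difference of the suffix sums, so the hypothesis says exactly that enough nodes are available.
-/
theorem exists_forest {g g' : List ℕ} (hg : g.length = g'.length)
    (h : ∀ n, (g.drop n).sum ≤ (g'.drop n).sum) :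
    ∃ (l : BinTree) (f : List BinTree), f.length + g.sum = g'.sum ∧ l.leftEdge ++ forestEdge f = runWord g ∧
      l.leftCanopy ++ forestCanopy f = runWord g' := by
  induction g generalizing g' with
  | nil =>
    obtain rfl : g' = [] := List.length_eq_zero_iff.1 hg.symm
    exact ⟨nil, [], rfl, rfl, rfl⟩
  | cons a g ih =>
    obtain ⟨b, g', rfl⟩ := List.exists_cons_of_length_eq_add_one hg.symm
    obtain ⟨l, f, hl, he, hc⟩ := ih (g' := g') (by simpa using hg) fun n => by
      simpa using h (n + 1)
    have h0 := h 0
    simp only [List.drop_zero, List.sum_cons] at h0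
    have he' := forestEdge_replicate_append b (l :: f)
    obtain ⟨m, f₁, hm⟩ := List.exists_cons_of_ne_nil
      (show List.replicate b nil ++ l :: f ≠ [] by simp)
    have hlen := congrArg List.length hm
    simp only [List.length_append, List.length_replicate, List.length_cons] at hlen
    obtain ⟨t, f', ht, h1, h2, h3⟩ := exists_merge a (t := node m nil) (by simp) (f := f₁) (by omega)
    have hc'' := forestCanopy_replicate_append b (l :: f)
    rw [hm] at he' hc''
    refine ⟨t, f', by simp only [List.sum_cons]; omega, ?_, ?_⟩
    · rw [leftEdge_of_ne ht, List.cons_append, h2, runWord, ← he]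
      simpa [edgePath_node, forestEdge] using he'
    · have : D :: (m.leftCanopy ++ forestCanopy f₁) = D :: (List.replicate b D ++ runWord g') := by
        have hD : ∀ x, D :: (List.replicate b D ++ x) = List.replicate b D ++ D :: x := fun x => by
          rw [← List.cons_append, ← List.replicate_succ, List.replicate_succ', List.append_assoc]
          rfl
        rw [← hc, hD]
        exact hc''
      rw [leftCanopy_of_ne ht, List.cons_append, h3, runWord, canopy_node]
      simpa [canopy] using this

theorem exists_of_runSum_le {k : ℕ} {v w : List DyckStep} (hv : v ∈ DyckPaths k)
    (hw : w ∈ DyckPaths k) (h : ∀ j ≤ k, runSum w j ≤ runSum v j) :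
    ∃ t, t ≠ nil ∧ t.edgePath = v ∧ t.canopy = w := by
  obtain ⟨l, f, hf, he, hc⟩ := exists_forest (g := downRuns v) (g' := downRuns w)
    (by rw [length_downRuns hv, length_downRuns hw]) fun n => by
      have h1 := List.sum_take_add_sum_drop (downRuns v) n
      have h2 := List.sum_take_add_sum_drop (downRuns w) n
      rw [sum_downRuns hv] at h1
      rw [sum_downRuns hw] at h2
      rcases le_total n k with hn | hn
      · have h3 := h n hn
        rw [runSum, runSum] at h3
        omega
      · rw [List.drop_eq_nil_of_le (by rw [length_downRuns hv]; exact hn)]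
        simp
  rw [sum_downRuns hv, sum_downRuns hw] at hf
  obtain rfl : f = [] := List.length_eq_zero_iff.1 (by omega)
  refine ⟨node l nil, by simp, ?_, ?_⟩
  · rw [← runWord_downRuns hv, ← he, edgePath_node]
    simp [forestEdge]
  · rw [← runWord_downRuns hw, ← hc, canopy_node]
    simp [forestCanopy, canopy]

/-! ### The two paths determine the tree -/

theorem leftEdge_append_forestEdge_ne (l : BinTree) (f : List BinTree) (x : List DyckStep) :
    l.leftEdge ++ forestEdge f ≠ D :: x := by
  induction f generalizing l with
  | nil => rcases eq_or_ne l nil with rfl | hl <;> simp [forestEdge, *, leftEdge_of_ne]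
  | cons m f ih =>
    rcases eq_or_ne l nil with rfl | hl
    · simpa [forestEdge] using ih m
    · simp [leftEdge_of_ne hl]

/-- Decoding is deterministic: the first letter of the canopy word tells whether the left subtree is
empty, and the first letter of the edge word whether a right child exists. A right child moves the
left subtree into the forest. -/
theorem forest_injective (n : ℕ) :
    (∀ (l : BinTree) (f : List BinTree) (l' : BinTree) (f' : List BinTree),
      (l.leftEdge ++ forestEdge f).length + (l.leftCanopy ++ forestCanopy f).length = n →
      l.leftEdge ++ forestEdge f = l'.leftEdge ++ forestEdge f' →
      l.leftCanopy ++ forestCanopy f = l'.leftCanopy ++ forestCanopy f' → l = l' ∧ f = f') ∧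
    (∀ (t : BinTree) (f : List BinTree) (t' : BinTree) (f' : List BinTree), t ≠ nil → t' ≠ nil →
      (t.edgePath ++ forestEdge f).length + (t.canopy ++ forestCanopy f).length = n →
      t.edgePath ++ forestEdge f = t'.edgePath ++ forestEdge f' →
      t.canopy ++ forestCanopy f = t'.canopy ++ forestCanopy f' → t = t' ∧ f = f') := by
  induction n using Nat.strong_induction_on with
  | _ n ih =>
    -- The second half uses this at the same `n`, since a root without right child consumes no
    -- letter.
    have key : ∀ (l : BinTree) (f : List BinTree) (l' : BinTree) (f' : List BinTree),
        (l.leftEdge ++ forestEdge f).length + (l.leftCanopy ++ forestCanopy f).length = n →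
        l.leftEdge ++ forestEdge f = l'.leftEdge ++ forestEdge f' →
        l.leftCanopy ++ forestCanopy f = l'.leftCanopy ++ forestCanopy f' → l = l' ∧ f = f' := by
      intro l f l' f' hn he hc
      rcases eq_or_ne l nil with rfl | hl <;> rcases eq_or_ne l' nil with rfl | hl'
      · simp only [leftEdge_nil, leftCanopy_nil, List.nil_append] at hn he hc
        rcases f with _ | ⟨m, f⟩ <;> rcases f' with _ | ⟨m', f'⟩
        · exact ⟨rfl, rfl⟩
        · simp [forestCanopy] at hc
        · simp [forestCanopy] at hc
        · simp only [forestCanopy, forestEdge, List.cons.injEq, true_and, List.length_cons]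
            at hn he hc
          obtain ⟨rfl, rfl⟩ := (ih _ (by omega)).1 m f m' f' rfl he hc
          exact ⟨rfl, rfl⟩
      · rcases f with _ | ⟨m, f⟩ <;> simp [leftCanopy_of_ne hl', forestCanopy] at hc
      · rcases f' with _ | ⟨m, f'⟩ <;> simp [leftCanopy_of_ne hl, forestCanopy] at hc
      · simp only [leftEdge_of_ne, leftCanopy_of_ne, ne_eq, hl, hl', not_false_eq_true,
          List.cons_append, List.length_cons, List.cons.injEq, true_and] at hn he hc
        exact (ih _ (by omega)).2 l f l' f' hl hl' rfl he hc
    refine ⟨key, ?_⟩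
    intro t f t' f' ht ht' hn he hc
    obtain _ | ⟨l, r⟩ := t
    · exact absurd rfl ht
    obtain _ | ⟨l', r'⟩ := t'
    · exact absurd rfl ht'
    rw [edgePath_node] at hn he
    rw [edgePath_node] at he
    rw [canopy_node] at hn hc
    rw [canopy_node] at hc
    rcases eq_or_ne r nil with rfl | hr <;> rcases eq_or_ne r' nil with rfl | hr'
    · simp only [if_true, List.nil_append, canopy] at hn he hc
      obtain ⟨rfl, rfl⟩ := key l f l' f' hn he hc
      exact ⟨rfl, rfl⟩
    · simp only [if_true, List.nil_append, if_neg hr', List.cons_append] at he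
      exact absurd he (leftEdge_append_forestEdge_ne l f _)
    · simp only [if_true, List.nil_append, if_neg hr, List.cons_append] at he
      exact absurd he.symm (leftEdge_append_forestEdge_ne l' f' _)
    · simp only [if_neg hr, if_neg hr', List.cons_append, List.append_assoc, List.nil_append,
        List.length_cons, List.cons.injEq, true_and] at hn he hc
      obtain ⟨rfl, h⟩ := (ih _ (by
        simp only [forestCanopy, forestEdge, List.length_append, List.length_cons] at hn ⊢
        omega)).2 r (l :: f) r' (l' :: f') hr hr' rfl he hc
      obtain ⟨rfl, rfl⟩ := List.cons_eq_cons.1 h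
      exact ⟨rfl, rfl⟩

theorem eq_of_edgePath_of_canopy {t t' : BinTree} (ht : t ≠ nil) (ht' : t' ≠ nil)
    (he : t.edgePath = t'.edgePath) (hc : t.canopy = t'.canopy) : t = t' :=
  ((forest_injective _).2 t [] t' [] ht ht' rfl (by rw [he]) (by rw [hc])).1

end BinTree

/-! ### Words in `S_n` -/

theorem mem_permWords_iff {n : ℕ} {w : List ℕ} :
    w ∈ PermWords n ↔ w.Nodup ∧ (∀ x ∈ w, 1 ≤ x ∧ x ≤ n) ∧ w.length = n := by
  constructor
  · intro h
    have h : w.Perm (List.range' 1 n) := h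
    refine ⟨h.nodup_iff.2 List.nodup_range', fun x hx => ?_, by simpa using h.length_eq⟩
    have := List.mem_range'_1.1 (h.mem_iff.1 hx)
    omega
  · rintro ⟨hn, hx, hl⟩
    refine (List.subperm_of_subset hn fun x h => ?_).perm_of_length_le (by simp [hl])
    have := hx x h
    rw [List.mem_range'_1]
    omega

theorem mem_of_mem_permWords {n x : ℕ} {w : List ℕ} (hw : w ∈ PermWords n) (h1 : 1 ≤ x)
    (hx : x ≤ n) : x ∈ w := by
  have h : w.Perm (List.range' 1 n) := hw
  rw [h.mem_iff, List.mem_range'_1]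
  omega

theorem isPermutation_of_mem_permWords {n : ℕ} {w : List ℕ} (hw : w ∈ PermWords n) :
    IsPermutation w :=
  ⟨(mem_permWords_iff.1 hw).1, fun x hx => ((mem_permWords_iff.1 hw).2.1 x hx).1⟩

theorem reverse_mem_permWords {n : ℕ} {w : List ℕ} (hw : w ∈ PermWords n) :
    w.reverse ∈ PermWords n := (List.reverse_perm w).trans hw

@[simp] theorem length_permInv (w : List ℕ) : (permInv w).length = w.length := by simp [permInv]

theorem permInv_mem_permWords {n : ℕ} {w : List ℕ} (hw : w ∈ PermWords n) :
    permInv w ∈ PermWords n := by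
  obtain ⟨hn, hx, hl⟩ := mem_permWords_iff.1 hw
  refine mem_permWords_iff.2 ⟨?_, ?_, by simp [hl]⟩
  · refine List.Nodup.map_on ?_ List.nodup_range'
    intro x hx y hy h
    rw [List.mem_range'_1, hl] at hx hy
    have hxw := mem_of_mem_permWords hw (x := x) (by omega) (by omega)
    exact (List.idxOf_inj hxw).1 (by omega)
  · simp only [permInv, List.mem_map, List.mem_range'_1, hl]
    rintro _ ⟨y, hy, rfl⟩
    have := List.idxOf_lt_length_of_mem
      (mem_of_mem_permWords hw (x := y) (by omega) (by omega))
    omega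

theorem permInv_permInv {n : ℕ} {w : List ℕ} (hw : w ∈ PermWords n) :
    permInv (permInv w) = w := by
  obtain ⟨hn, hx, hl⟩ := mem_permWords_iff.1 hw
  refine List.ext_getElem (by simp) fun i h1 h2 => ?_
  have h3 := hx w[i] (List.getElem_mem h2)
  have h4 : (permInv w)[w[i] - 1]'(by simp; omega) = i + 1 := by
    simp only [permInv, List.getElem_map, List.getElem_range']
    rw [show 1 + 1 * (w[i] - 1) = w[i] by omega, hn.idxOf_getElem]
  have h5 := (mem_permWords_iff.1 (permInv_mem_permWords hw)).1.idxOf_getElem (w[i] - 1)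
    (by simp; omega)
  rw [h4] at h5
  conv_lhs => simp only [permInv]
  simp only [List.getElem_map, List.getElem_range']
  rw [show 1 + 1 * i = i + 1 by omega]
  change (permInv w).idxOf (i + 1) + 1 = w[i]
  omega

theorem rot_mem_permWords {n : ℕ} {w : List ℕ} (hw : w ∈ PermWords n) : rot w ∈ PermWords n :=
  reverse_mem_permWords (permInv_mem_permWords hw)

theorem rotInv_rot {n : ℕ} {w : List ℕ} (hw : w ∈ PermWords n) : rotInv (rot w) = w := by
  rw [rotInv, rot, List.reverse_reverse, permInv_permInv hw]

theorem rot_rotInv {n : ℕ} {w : List ℕ} (hw : w ∈ PermWords n) : rot (rotInv w) = w := by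
  rw [rot, rotInv, permInv_permInv (reverse_mem_permWords hw), List.reverse_reverse]

theorem countP_le_range' (o s x : ℕ) :
    (List.range' (o + 1) s).countP (· ≤ x) = min s (x - o) := by
  induction s with
  | zero => simp
  | succ s ih =>
    rw [List.range'_1_concat, List.countP_append, ih]
    by_cases h : o + 1 + s ≤ x
    · simp [h]; omega
    · simp [h]; omega

theorem countP_ge_range' (o s x : ℕ) :
    (List.range' (o + 1) s).countP (x ≤ ·) = min s (o + s + 1 - x) := by
  induction s with
  | zero => simp
  | succ s ih =>
    rw [List.range'_1_concat, List.countP_append, ih]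
    by_cases h : x ≤ o + 1 + s
    · simp [h]; omega
    · simp [h]; omega

theorem countP_le_of_mem_permWords {n x : ℕ} {w : List ℕ} (hw : w ∈ PermWords n) (hx : x ≤ n) :
    w.countP (· ≤ x) = x := by
  have h : w.Perm (List.range' (0 + 1) n) := by simpa [PermWords] using hw
  rw [h.countP_eq, countP_le_range']
  omega

/-! ### Sliding operators -/

theorem countP_lt_countP {l : List ℕ} {p q : ℕ → Bool} (h : ∀ x ∈ l, p x → q x) {y : ℕ}
    (hy : y ∈ l) (hq : q y) (hp : ¬ p y) : l.countP p < l.countP q := by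
  induction l with
  | nil => simp at hy
  | cons a l ih =>
    have hl : l.countP p ≤ l.countP q :=
      List.countP_mono_left fun x hx => h x (List.mem_cons_of_mem _ hx)
    have ha := h a (by simp)
    rw [List.countP_cons, List.countP_cons]
    rcases List.mem_cons.1 hy with rfl | hy
    · simp [hq, hp]; omega
    · have := ih (fun x hx => h x (List.mem_cons_of_mem _ hx)) hy
      split_ifs <;> first | omega | simp_all

/-- The right letters fill an initial interval and the left letters the interval ending at `i - 1`;
their numbers add up to `i - 1`, so the intervals are disjoint. -/
theorem swuAt_mem_permWords {n i : ℕ} {w : List ℕ} (hw : w ∈ PermWords n) (h1 : 1 ≤ i)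
    (hi : i ≤ n) : swuAt i w ∈ PermWords n := by
  obtain ⟨hn, hx, hl⟩ := mem_permWords_iff.1 hw
  have hiw := mem_of_mem_permWords hw h1 hi
  have hmem : ∀ x ∈ w, x < i → x ∈ rightSmaller i w ∨ x ∈ leftSmaller i w := by
    intro x hx hlt
    rw [← List.take_append_drop (w.idxOf i) w, List.mem_append] at hx
    simp only [rightSmaller, leftSmaller, List.mem_filter]
    rcases hx with hx | hx
    · exact .inr ⟨hx, by simpa using hlt⟩
    · exact .inl ⟨hx, by simpa using hlt⟩
  have hcard : (rightSmaller i w).length + (leftSmaller i w).length = i - 1 := by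
    have := countP_le_of_mem_permWords hw (x := i - 1) (by omega)
    rw [← List.take_append_drop (w.idxOf i) w, List.countP_append, List.countP_eq_length_filter,
      List.countP_eq_length_filter] at this
    have e : (fun x : ℕ => decide (x ≤ i - 1)) = fun x => decide (x < i) := by
      ext x
      simp
      omega
    rw [e] at this
    rw [rightSmaller, leftSmaller]
    omega
  have hR : ∀ x ∈ rightSmaller i w, 1 ≤ ((rightSmaller i w).filter (· ≤ x)).length ∧
      ((rightSmaller i w).filter (· ≤ x)).length ≤ (rightSmaller i w).length := fun x hx =>
    ⟨List.length_pos_of_mem (List.mem_filter.2 ⟨hx, by simp⟩), List.length_filter_le _ _⟩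
  have hL : ∀ x ∈ leftSmaller i w, 1 ≤ ((leftSmaller i w).filter (x ≤ ·)).length ∧
      ((leftSmaller i w).filter (x ≤ ·)).length ≤ (leftSmaller i w).length := fun x hx =>
    ⟨List.length_pos_of_mem (List.mem_filter.2 ⟨hx, by simp⟩), List.length_filter_le _ _⟩
  have hRR : ∀ x y, y ∈ rightSmaller i w → x < y →
      ((rightSmaller i w).filter (· ≤ x)).length < ((rightSmaller i w).filter (· ≤ y)).length := by
    intro x y hy hxy
    rw [← List.countP_eq_length_filter, ← List.countP_eq_length_filter]
    exact countP_lt_countP (fun z _ => by simp; omega) hy (by simp) (by simpa using hxy)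
  have hLL : ∀ x y, x ∈ leftSmaller i w → x < y →
      ((leftSmaller i w).filter (y ≤ ·)).length < ((leftSmaller i w).filter (x ≤ ·)).length := by
    intro x y hx hxy
    rw [← List.countP_eq_length_filter, ← List.countP_eq_length_filter]
    exact countP_lt_countP (fun z _ => by simp; omega) hx (by simp) (by simpa using hxy)
  refine mem_permWords_iff.2 ⟨hn.map_on ?_, ?_, by simp [swuAt, hl]⟩
  · intro x hxw y hyw h
    wlog hxy : x < y generalizing x y
    · rcases lt_or_eq_of_le (not_lt.1 hxy) with hlt | heq
      · exact (this y hyw x hxw h.symm hlt).symm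
      · exact heq.symm
    exfalso
    split_ifs at h with a1 a2 a3 a4 a5 a6 a7 a8
    · omega
    · omega
    · omega
    · have := hR x a4
      omega
    · have := hRR x y a6 hxy
      omega
    · have := hR x a4
      have := hL y ((hmem y hyw (not_le.1 a5)).resolve_left a6)
      omega
    · have := hL x ((hmem x hxw (not_le.1 a1)).resolve_left a4)
      omega
    · have := hL x ((hmem x hxw (not_le.1 a1)).resolve_left a4)
      have := hR y a8
      omega
    · have h1 := (hmem x hxw (not_le.1 a1)).resolve_left a4
      have := hL x h1
      have := hLL x y h1 hxy
      omega
  · simp only [swuAt, List.mem_map]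
    rintro _ ⟨x, hxw, rfl⟩
    have := hx x hxw
    split_ifs with a1 a2
    · exact this
    · have := hR x a2
      omega
    · have := hL x ((hmem x hxw (not_le.1 a1)).resolve_left a2)
      omega

theorem foldr_swuAt_mem_permWords {n : ℕ} {w : List ℕ} (hw : w ∈ PermWords n) {L : List ℕ}
    (hL : ∀ i ∈ L, 1 ≤ i ∧ i ≤ n) : L.foldr swuAt w ∈ PermWords n := by
  induction L with
  | nil => exact hw
  | cons i L ih =>
    have := hL i (by simp)
    exact swuAt_mem_permWords (ih fun j hj => hL j (by simp [hj])) this.1 this.2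

theorem foldr_swdAt_eq (w L : List ℕ) :
    L.foldr swdAt w = (L.foldr swuAt w.reverse).reverse := by
  induction L with
  | nil => simp
  | cons i L ih => simp [ih, swdAt]

theorem swl_eq {n : ℕ} {w : List ℕ} (hw : w ∈ PermWords n) :
    swl w = rotInv ((List.range' 1 n).foldr swuAt (rot w)) := by
  have h : ∀ L : List ℕ, (∀ i ∈ L, 1 ≤ i ∧ i ≤ n) →
      L.foldr swlAt w = rotInv (L.foldr swuAt (rot w)) := by
    intro L hL
    induction L with
    | nil => exact (rotInv_rot hw).symm
    | cons i L ih =>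
      have hL' : ∀ j ∈ L, 1 ≤ j ∧ j ≤ n := fun j hj => hL j (by simp [hj])
      rw [List.foldr_cons, ih hL', swlAt,
        rot_rotInv (foldr_swuAt_mem_permWords (rot_mem_permWords hw) hL'), List.foldr_cons]
  rw [swl, (mem_permWords_iff.1 hw).2.2]
  refine h _ fun i hi => ?_
  rw [List.mem_range'_1] at hi
  omega

theorem swr_eq {n : ℕ} {w : List ℕ} (hw : w ∈ PermWords n) :
    swr w = rotInv ((List.range' 1 n).foldr swdAt (rot w)) := by
  have h : ∀ L : List ℕ, (∀ i ∈ L, 1 ≤ i ∧ i ≤ n) →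
      L.foldr swrAt w = rotInv (L.foldr swdAt (rot w)) := by
    intro L hL
    induction L with
    | nil => exact (rotInv_rot hw).symm
    | cons i L ih =>
      have hL' : ∀ j ∈ L, 1 ≤ j ∧ j ≤ n := fun j hj => hL j (by simp [hj])
      rw [List.foldr_cons, ih hL', swrAt, rot_rotInv, List.foldr_cons]
      rw [foldr_swdAt_eq]
      exact reverse_mem_permWords (foldr_swuAt_mem_permWords
        (reverse_mem_permWords (rot_mem_permWords hw)) hL')
  rw [swr, (mem_permWords_iff.1 hw).2.2]
  refine h _ fun i hi => ?_
  rw [List.mem_range'_1] at hi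
  omega

/-! ### Rotated reading words -/

namespace BinTree

/-- The rotation of `post`: the positions of the nodes in postorder, listed in reversed inorder. -/
def rotPost (o : ℕ) : BinTree → List ℕ
  | nil => []
  | node l r => r.rotPost (o + l.size) ++ [o + l.size + r.size + 1] ++ l.rotPost o

/-- The rotation of `anti`. -/
def rotAnti (o : ℕ) : BinTree → List ℕ
  | nil => []
  | node l r => r.rotAnti o ++ [o + l.size + r.size + 1] ++ l.rotAnti (o + r.size)

/-- Reflection of a binary tree. -/
def mirror : BinTree → BinTree
  | nil => nil
  | node l r => node r.mirror l.mirror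

@[simp] theorem size_mirror (t : BinTree) : t.mirror.size = t.size := by
  induction t with
  | nil => rfl
  | node l r hl hr => simp [mirror, size, hl, hr, add_comm]

/-- Reversal mirrors the tree and exchanges the two readings, which reduces `swr` to the computation
for `swl`. -/
theorem reverse_rotPost (t : BinTree) (o : ℕ) : (t.rotPost o).reverse = t.mirror.rotAnti o := by
  induction t generalizing o with
  | nil => rfl
  | node l r hl hr => simp [mirror, rotPost, rotAnti, hl, hr, add_right_comm]

theorem reverse_rotAnti (t : BinTree) (o : ℕ) : (t.rotAnti o).reverse = t.mirror.rotPost o := by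
  induction t generalizing o with
  | nil => rfl
  | node l r hl hr => simp [mirror, rotPost, rotAnti, hl, hr, add_right_comm]

theorem map_idxOf_post (t : BinTree) (o q : ℕ) :
    (List.range' (o + 1) t.size).map (fun v => q + (t.post o).idxOf v + 1) =
      (t.rotPost q).reverse := by
  induction t generalizing o q with
  | nil => rfl
  | node l r hl hr =>
    rw [size, range'_split, List.map_append, List.map_cons, post, rotPost, List.reverse_append,
      List.reverse_append, ← hl o q, ← hr (o + l.size + 1) (q + l.size)]
    simp only [List.reverse_singleton, List.append_assoc, List.singleton_append]
    congr 1
    · refine List.map_congr_left fun v hv => ?_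
      rw [List.mem_range'_1] at hv
      rw [List.idxOf_append_of_mem (mem_post.2 (by omega))]
    congr 1
    · rw [List.idxOf_append_of_notMem (by rw [mem_post]; omega),
        List.idxOf_append_of_notMem (by rw [mem_post]; omega)]
      simp
      omega
    · refine List.map_congr_left fun v hv => ?_
      rw [List.mem_range'_1] at hv
      rw [List.idxOf_append_of_notMem (by rw [mem_post]; omega),
        List.idxOf_append_of_mem (mem_post.2 (by omega))]
      simp
      omega

theorem map_idxOf_anti (t : BinTree) (o q : ℕ) :
    (List.range' (o + 1) t.size).map (fun v => q + (t.anti o).idxOf v + 1) =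
      (t.rotAnti q).reverse := by
  induction t generalizing o q with
  | nil => rfl
  | node l r hl hr =>
    rw [size, range'_split, List.map_append, List.map_cons, anti, rotAnti, List.reverse_append,
      List.reverse_append, ← hl o (q + r.size), ← hr (o + l.size + 1) q]
    simp only [List.reverse_singleton, List.append_assoc, List.singleton_append]
    congr 1
    · refine List.map_congr_left fun v hv => ?_
      rw [List.mem_range'_1] at hv
      rw [List.idxOf_append_of_notMem (by rw [mem_anti]; omega),
        List.idxOf_append_of_mem (mem_anti.2 (by omega))]
      simp
      omega
    congr 1
    · rw [List.idxOf_append_of_notMem (by rw [mem_anti]; omega),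
        List.idxOf_append_of_notMem (by rw [mem_anti]; omega)]
      simp
      omega
    · refine List.map_congr_left fun v hv => ?_
      rw [List.mem_range'_1] at hv
      rw [List.idxOf_append_of_mem (mem_anti.2 (by omega))]

theorem rot_post (t : BinTree) : rot (t.post 0) = t.rotPost 0 := by
  have := t.map_idxOf_post 0 0
  simp only [zero_add] at this
  rw [rot, permInv, length_post, this, List.reverse_reverse]

theorem rot_anti (t : BinTree) : rot (t.anti 0) = t.rotAnti 0 := by
  have := t.map_idxOf_anti 0 0
  simp only [zero_add] at this
  rw [rot, permInv, length_anti, this, List.reverse_reverse]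

theorem post_mem_permWords (t : BinTree) : t.post 0 ∈ PermWords t.size := by
  have h := t.post_perm 0
  rw [zero_add] at h
  exact h

theorem anti_mem_permWords (t : BinTree) : t.anti 0 ∈ PermWords t.size := by
  have h := t.anti_perm 0
  rw [zero_add] at h
  exact h

theorem rotAnti_perm (t : BinTree) (o : ℕ) :
    (t.rotAnti o).Perm (List.range' (o + 1) t.size) := by
  induction t generalizing o with
  | nil => simp [rotAnti, size]
  | node l r hl hr =>
    rw [rotAnti, size, ← List.range'_append_1, add_comm l.size r.size, ← List.range'_append_1,
      List.append_assoc, List.append_assoc]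
    refine (hr o).append (List.perm_append_comm.trans ?_)
    rw [add_right_comm o 1, List.range'_one, show o + 1 + (r.size + l.size) =
      o + l.size + r.size + 1 by omega]
    exact (hl _).append_right _

theorem mem_rotAnti {t : BinTree} {o x : ℕ} : x ∈ t.rotAnti o ↔ o < x ∧ x ≤ o + t.size := by
  rw [(rotAnti_perm t o).mem_iff, List.mem_range'_1]
  omega

theorem map_add_rotAnti (t : BinTree) (o a : ℕ) :
    (t.rotAnti o).map (· + a) = t.rotAnti (o + a) := by
  induction t generalizing o with
  | nil => rfl
  | node l r hl hr =>
    simp only [rotAnti, List.map_append, hl, hr, List.map_cons, List.map_nil]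
    rw [show o + a + l.size + r.size + 1 = o + l.size + r.size + 1 + a by omega,
      show o + a + r.size = o + r.size + a by omega]

/-- One sliding step at the root of a tree inside a permutation. -/
theorem swuAt_root {n o : ℕ} {l r : BinTree} {X Z : List ℕ}
    (hw : X ++ (r.rotAnti o ++ [o + l.size + r.size + 1] ++ l.rotAnti (o + r.size)) ++ Z ∈
      PermWords n)
    (hX : ∀ x ∈ X, o + l.size + r.size + 1 < x)
    (hZ : ∀ x ∈ Z, x ≤ o ∨ o + l.size + r.size + 1 < x) :
    swuAt (o + l.size + r.size + 1)
      (X ++ (r.rotAnti o ++ [o + l.size + r.size + 1] ++ l.rotAnti (o + r.size)) ++ Z) =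
      X ++ (r.rotAnti (o + l.size) ++ [o + l.size + r.size + 1] ++ l.rotAnti o) ++ Z := by
  set m := o + l.size + r.size + 1 with hm
  have ew : X ++ (r.rotAnti o ++ [m] ++ l.rotAnti (o + r.size)) ++ Z =
      (X ++ r.rotAnti o) ++ m :: (l.rotAnti (o + r.size) ++ Z) := by simp
  have hidx : ((X ++ r.rotAnti o) ++ m :: (l.rotAnti (o + r.size) ++ Z)).idxOf m =
      (X ++ r.rotAnti o).length := by
    rw [List.idxOf_append_of_notMem]
    · simp
    · rw [List.mem_append, mem_rotAnti]
      rintro (h | h)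
      · exact lt_irrefl _ (hX m h)
      · omega
  have hL : leftSmaller m ((X ++ r.rotAnti o) ++ m :: (l.rotAnti (o + r.size) ++ Z)) =
      r.rotAnti o := by
    rw [leftSmaller, hidx, List.take_left, List.filter_append, List.filter_eq_nil_iff.2,
      List.filter_eq_self.2, List.nil_append]
    · intro x hx
      rw [mem_rotAnti] at hx
      simp; omega
    · intro x hx
      have := hX x hx
      simp; omega
  have hR : rightSmaller m ((X ++ r.rotAnti o) ++ m :: (l.rotAnti (o + r.size) ++ Z)) =
      (l.rotAnti (o + r.size) ++ Z).filter (· < m) := by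
    rw [rightSmaller, hidx, List.drop_left]
    simp
  -- Exactly `x` letters are at most `x`. With the shares of `X` and of the right subtree known,
  -- this yields the number to the right of `m`, which is the new value of a small letter there.
  have hcount : ∀ x ≤ n, X.countP (· ≤ x) + (r.rotAnti o).countP (· ≤ x) +
      ((if m ≤ x then 1 else 0) + (l.rotAnti (o + r.size) ++ Z).countP (· ≤ x)) = x := by
    intro x hx
    have := countP_le_of_mem_permWords hw hx
    rw [ew] at this
    simpa [List.countP_cons, add_comm, add_left_comm, add_assoc] using this
  have hX0 : ∀ x ≤ m, X.countP (· ≤ x) = 0 := by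
    intro x hx
    rw [List.countP_eq_zero]
    intro y hy
    have := hX y hy
    simp; omega
  have hfilter : ∀ x < m, (((l.rotAnti (o + r.size) ++ Z).filter (· < m)).filter (· ≤ x)).length =
      (l.rotAnti (o + r.size) ++ Z).countP (· ≤ x) := by
    intro x hx
    rw [List.filter_filter, List.countP_eq_length_filter]
    congr 1
    refine List.filter_congr fun y _ => ?_
    simp; omega
  have hmn : m ≤ n := ((mem_permWords_iff.1 hw).2.1 m (by simp)).2
  have hnd := (mem_permWords_iff.1 hw).1
  rw [ew] at hnd ⊢
  rw [swuAt, hL, hR]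
  simp only [List.map_append, List.map_cons, le_refl, if_true]
  have eX : X.map (fun x => if m ≤ x then x else
      if x ∈ (l.rotAnti (o + r.size) ++ Z).filter (· < m) then
        (((l.rotAnti (o + r.size) ++ Z).filter (· < m)).filter (· ≤ x)).length
      else m - ((r.rotAnti o).filter (x ≤ ·)).length) = X := by
    conv_rhs => rw [← List.map_id X]
    refine List.map_congr_left fun x hx => ?_
    rw [if_pos (hX x hx).le, id]
  have er : (r.rotAnti o).map (fun x => if m ≤ x then x else
      if x ∈ (l.rotAnti (o + r.size) ++ Z).filter (· < m) then
        (((l.rotAnti (o + r.size) ++ Z).filter (· < m)).filter (· ≤ x)).length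
      else m - ((r.rotAnti o).filter (x ≤ ·)).length) = r.rotAnti (o + l.size) := by
    rw [← map_add_rotAnti r o l.size]
    refine List.map_congr_left fun x hx => ?_
    have hx' := mem_rotAnti.1 hx
    rw [if_neg (by omega), if_neg, ← List.countP_eq_length_filter, (rotAnti_perm r o).countP_eq,
      countP_ge_range']
    · omega
    · intro h
      have h := (List.mem_filter.1 h).1
      exact (List.nodup_append.1 hnd).2.2 x (by simp [hx]) x (List.mem_cons_of_mem _ h) rfl
  have el : (l.rotAnti (o + r.size)).map (fun x => if m ≤ x then x else
      if x ∈ (l.rotAnti (o + r.size) ++ Z).filter (· < m) then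
        (((l.rotAnti (o + r.size) ++ Z).filter (· < m)).filter (· ≤ x)).length
      else m - ((r.rotAnti o).filter (x ≤ ·)).length) = l.rotAnti o := by
    have : (l.rotAnti o).map (· + r.size) = l.rotAnti (o + r.size) := map_add_rotAnti ..
    rw [← this, List.map_map]
    conv_rhs => rw [← List.map_id (l.rotAnti o)]
    refine List.map_congr_left fun y hy => ?_
    have hy' := mem_rotAnti.1 hy
    rw [this, Function.comp_apply, id, if_neg (by omega), if_pos, hfilter _ (by omega)]
    · have h1 := hcount (y + r.size) (by omega)
      rw [hX0 _ (by omega), if_neg (by omega), (rotAnti_perm r o).countP_eq,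
        countP_le_range'] at h1
      omega
    · rw [List.mem_filter, List.mem_append, mem_rotAnti]
      exact ⟨.inl (by omega), by simp; omega⟩
  have eZ : Z.map (fun x => if m ≤ x then x else
      if x ∈ (l.rotAnti (o + r.size) ++ Z).filter (· < m) then
        (((l.rotAnti (o + r.size) ++ Z).filter (· < m)).filter (· ≤ x)).length
      else m - ((r.rotAnti o).filter (x ≤ ·)).length) = Z := by
    conv_rhs => rw [← List.map_id Z]
    refine List.map_congr_left fun x hx => ?_
    rw [id]
    rcases hZ x hx with h | h
    · rw [if_neg (by omega), if_pos, hfilter _ (by omega)]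
      · have h1 := hcount x (by omega)
        rw [hX0 _ (by omega), if_neg (by omega), (rotAnti_perm r o).countP_eq,
          countP_le_range'] at h1
        omega
      · rw [List.mem_filter, List.mem_append]
        exact ⟨.inr hx, by simp; omega⟩
    · rw [if_pos h.le]
  rw [eX, er, el, eZ]
  simp

/-- Each step exchanges the value ranges below one root. The conditions on `X` and `Z` persist in
the subtrees, so each root's smaller letters on the left belong to its own right subtree. -/
theorem foldr_swuAt_rotAnti {n : ℕ} (t : BinTree) {o : ℕ} {X Z : List ℕ}
    (hw : X ++ t.rotAnti o ++ Z ∈ PermWords n) (hX : ∀ x ∈ X, o + t.size < x)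
    (hZ : ∀ x ∈ Z, x ≤ o ∨ o + t.size < x) :
    (List.range' (o + 1) t.size).foldr swuAt (X ++ t.rotAnti o ++ Z) =
      X ++ t.rotPost o ++ Z := by
  induction t generalizing o X Z with
  | nil => rfl
  | node l r hl hr =>
    -- The last index acts first under `foldr`: the root, then the right subtree, by now on the
    -- larger labels, then the left subtree.
    have e : List.range' (o + 1) (node l r).size = List.range' (o + 1) l.size ++
        (List.range' (o + l.size + 1) r.size ++ [o + l.size + r.size + 1]) := by
      rw [size, ← List.range'_append_1, ← List.range'_append_1, List.append_assoc,
        add_right_comm o 1, List.range'_one]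
      congr 3
      omega
    simp only [size] at hX hZ
    rw [rotAnti] at hw
    have hroot := swuAt_root hw (by simpa [add_assoc] using hX) (by simpa [add_assoc] using hZ)
    have hm : o + l.size + r.size + 1 ≤ n := ((mem_permWords_iff.1 hw).2.1 _ (by simp)).2
    have hw1 := swuAt_mem_permWords hw (i := o + l.size + r.size + 1) (by omega) hm
    rw [hroot] at hw1
    have hr1 := hr (o := o + l.size) (X := X)
      (Z := [o + l.size + r.size + 1] ++ l.rotAnti o ++ Z) (by simpa using hw1)
      (fun x hx => by have := hX x hx; omega) (by
        intro x hx
        simp only [List.mem_append, List.mem_singleton, mem_rotAnti] at hx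
        rcases hx with (hx | hx) | hx
        · omega
        · omega
        · have := hZ x hx
          omega)
    have hw2 := foldr_swuAt_mem_permWords hw1 (L := List.range' (o + l.size + 1) r.size) (by
      intro i hi
      rw [List.mem_range'_1] at hi
      omega)
    have e1 : X ++ (r.rotAnti (o + l.size) ++ [o + l.size + r.size + 1] ++ l.rotAnti o) ++ Z =
      X ++ r.rotAnti (o + l.size) ++ ([o + l.size + r.size + 1] ++ l.rotAnti o ++ Z) := by simp
    rw [e1, hr1] at hw2
    have e2 : X ++ r.rotPost (o + l.size) ++ ([o + l.size + r.size + 1] ++ l.rotAnti o ++ Z) =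
      X ++ r.rotPost (o + l.size) ++ [o + l.size + r.size + 1] ++ l.rotAnti o ++ Z := by simp
    have hmem : ∀ x, x ∈ r.rotPost (o + l.size) → o + l.size < x := by
      intro x hx
      rw [← List.mem_reverse, reverse_rotPost, mem_rotAnti] at hx
      exact hx.1
    have hl1 := hl (o := o) (X := X ++ r.rotPost (o + l.size) ++ [o + l.size + r.size + 1])
      (Z := Z) (by rw [← e2]; exact hw2) (by
        intro x hx
        simp only [List.mem_append, List.mem_singleton] at hx
        rcases hx with (hx | hx) | hx
        · have := hX x hx
          omega
        · exact hmem x hx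
        · omega) (fun x hx => by have := hZ x hx; omega)
    rw [e, List.foldr_append, List.foldr_append, List.foldr_cons, List.foldr_nil, rotAnti, hroot,
      e1, hr1, e2, hl1, rotPost]
    simp

theorem foldr_swuAt_rotAnti_zero (t : BinTree) :
    (List.range' 1 t.size).foldr swuAt (t.rotAnti 0) = t.rotPost 0 := by
  have h : t.rotAnti 0 ∈ PermWords t.size := by
    have h := t.rotAnti_perm 0
    rw [zero_add] at h
    exact h
  simpa using t.foldr_swuAt_rotAnti (n := t.size) (o := 0) (X := []) (Z := []) (by simpa using h)

theorem swl_anti (t : BinTree) : swl (t.anti 0) = t.post 0 := by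
  rw [swl_eq t.anti_mem_permWords, rot_anti, foldr_swuAt_rotAnti_zero, ← rot_post,
    rotInv_rot t.post_mem_permWords]

theorem swr_post (t : BinTree) : swr (t.post 0) = t.anti 0 := by
  have h := foldr_swuAt_rotAnti_zero t.mirror
  rw [size_mirror] at h
  rw [swr_eq t.post_mem_permWords, rot_post, foldr_swdAt_eq, reverse_rotPost, h,
    ← reverse_rotAnti, List.reverse_reverse, ← rot_anti, rotInv_rot t.anti_mem_permWords]

end BinTree

/-! ### Pattern avoidance -/

theorem contains_312_iff {w : List ℕ} :
    Contains w [3, 1, 2] ↔ ∃ a b c, [a, b, c].Sublist w ∧ b < c ∧ c < a := by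
  have h0 : normalize [3, 1, 2] = [3, 1, 2] := by decide
  rw [Contains, h0]
  constructor
  · rintro ⟨u, hu, e⟩
    have hl : u.length = 3 := by simpa [normalize] using congrArg List.length e
    obtain ⟨a, b, c, rfl⟩ := List.length_eq_three.1 hl
    refine ⟨a, b, c, hu, ?_⟩
    simp only [normalize, List.map_cons, List.map_nil, List.filter_cons, List.filter_nil] at e
    clear hu h0 hl
    grind
  · rintro ⟨a, b, c, hu, h1, h2⟩
    refine ⟨_, hu, ?_⟩
    have h3 := h1.trans h2
    simp [normalize, List.filter_cons, h1.le, h1.not_ge, h2.le, h2.not_ge, h3.le, h3.not_ge]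

theorem contains_132_iff {w : List ℕ} :
    Contains w [1, 3, 2] ↔ ∃ a b c, [a, b, c].Sublist w ∧ a < c ∧ c < b := by
  have h0 : normalize [1, 3, 2] = [1, 3, 2] := by decide
  rw [Contains, h0]
  constructor
  · rintro ⟨u, hu, e⟩
    have hl : u.length = 3 := by simpa [normalize] using congrArg List.length e
    obtain ⟨a, b, c, rfl⟩ := List.length_eq_three.1 hl
    refine ⟨a, b, c, hu, ?_⟩
    simp only [normalize, List.map_cons, List.map_nil, List.filter_cons, List.filter_nil] at e
    clear hu h0 hl
    grind
  · rintro ⟨a, b, c, hu, h1, h2⟩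
    refine ⟨_, hu, ?_⟩
    have h3 := h1.trans h2
    simp [normalize, List.filter_cons, h1.le, h1.not_ge, h2.le, h2.not_ge, h3.le, h3.not_ge]

theorem eq_filter_append_filter (p : ℕ → Bool) {l : List ℕ}
    (h : ∀ a b, [a, b].Sublist l → p b → p a) :
    l = l.filter p ++ l.filter (fun x => !p x) := by
  induction l with
  | nil => rfl
  | cons a l ih =>
    have hl := ih fun x y hxy => h x y (hxy.cons a)
    by_cases ha : p a
    · simp only [List.filter_cons, ha, if_true, List.cons_append]
      simpa using hl
    · have : ∀ b ∈ l, ¬ p b := fun b hb hpb =>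
        ha (h a b (List.cons_sublist_cons.2 (List.singleton_sublist.2 hb)) hpb)
      have h1 : l.filter p = [] := List.filter_eq_nil_iff.2 this
      have h2 : l.filter (fun x => !p x) = l := List.filter_eq_self.2 (by simpa using this)
      simp [ha, h1, h2]

/-- The letters below and above the last letter of a word on an interval of integers. -/
theorem exists_filter_perm {o n v : ℕ} {w : List ℕ}
    (h : (w ++ [v]).Perm (List.range' (o + 1) (n + 1))) :
    ∃ a b, a + b = n ∧ v = o + a + 1 ∧ (w.filter (· < v)).Perm (List.range' (o + 1) a) ∧
      (w.filter (fun x => !decide (x < v))).Perm (List.range' (o + a + 1 + 1) b) := by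
  have hn : (w ++ [v]).Nodup := h.nodup_iff.2 List.nodup_range'
  have hmem : ∀ x, (x ∈ w ∨ x = v) ↔ o + 1 ≤ x ∧ x < o + 1 + (n + 1) := by
    intro x
    have := h.mem_iff (a := x)
    rwa [List.mem_range'_1, List.mem_append, List.mem_singleton] at this
  have hv := (hmem v).1 (.inr rfl)
  have hvw : v ∉ w := fun hv => (List.nodup_append.1 hn).2.2 v hv v (by simp) rfl
  have hw := (List.nodup_append.1 hn).1
  refine ⟨v - o - 1, n - (v - o - 1), by omega, by omega, ?_, ?_⟩
  · refine (List.perm_ext_iff_of_nodup (hw.filter _) List.nodup_range').2 fun x => ?_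
    have := hmem x
    rw [List.mem_filter, List.mem_range'_1, decide_eq_true_iff]
    constructor
    · rintro ⟨h1, h2⟩
      have := this.1 (.inl h1)
      omega
    · intro h
      exact ⟨(this.2 (by omega)).resolve_right (by omega), by omega⟩
  · refine (List.perm_ext_iff_of_nodup (hw.filter _) List.nodup_range').2 fun x => ?_
    have := hmem x
    rw [List.mem_filter, List.mem_range'_1]
    simp only [Bool.not_eq_true', decide_eq_false_iff_not, not_lt]
    constructor
    · rintro ⟨h1, h2⟩
      have h3 := this.1 (.inl h1)
      have : x ≠ v := by rintro rfl; exact hvw h1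
      omega
    · intro h
      exact ⟨(this.2 (by omega)).resolve_right (by omega), by omega⟩

namespace BinTree

/-- The last letter is the root. As the final letter of a forbidden 312 it forces all smaller
letters before all larger ones. -/
theorem exists_post_eq {o n : ℕ} {w : List ℕ} (hw : w.Perm (List.range' (o + 1) n))
    (h : ∀ a b c, [a, b, c].Sublist w → b < c → ¬ c < a) : ∃ t : BinTree, t.post o = w := by
  induction n using Nat.strong_induction_on generalizing o w with
  | _ n ih =>
    rcases List.eq_nil_or_concat w with rfl | ⟨w, v, rfl⟩
    · exact ⟨nil, rfl⟩
    rw [List.concat_eq_append] at hw h ⊢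
    obtain ⟨n, rfl⟩ : ∃ m, n = m + 1 := ⟨n - 1, by have := hw.length_eq; simp at this; omega⟩
    obtain ⟨a, b, hab, rfl, hl, hr⟩ := exists_filter_perm hw
    have hs : ∀ u : List ℕ, u.Sublist w → u.Sublist (w ++ [o + a + 1]) := fun u hu =>
      hu.trans (List.sublist_append_left _ _)
    obtain ⟨l, el⟩ := ih a (by omega) hl fun x y z hxyz =>
      h x y z (hs _ (hxyz.trans List.filter_sublist))
    obtain ⟨r, er⟩ := ih b (by omega) hr fun x y z hxyz =>
      h x y z (hs _ (hxyz.trans List.filter_sublist))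
    have hsize : l.size = a := by rw [← length_post l o, el, hl.length_eq, List.length_range']
    refine ⟨node l r, ?_⟩
    rw [post, hsize, el, er, ← eq_filter_append_filter]
    intro x y hxy hy
    have hx : x ∈ w := hxy.subset (by simp)
    have hne : x ≠ o + a + 1 := by
      rintro rfl
      have hn : (w ++ [o + a + 1]).Nodup := hw.nodup_iff.2 List.nodup_range'
      exact (List.nodup_append.1 hn).2.2 _ hx _ (by simp) rfl
    have := h x y (o + a + 1) (hxy.append (List.Sublist.refl [o + a + 1])) (by simpa using hy)
    simp
    omega

/-- As the final letter of a forbidden 132, the root forces all larger letters before all smaller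
ones. -/
theorem exists_anti_eq {o n : ℕ} {w : List ℕ} (hw : w.Perm (List.range' (o + 1) n))
    (h : ∀ a b c, [a, b, c].Sublist w → a < c → ¬ c < b) : ∃ t : BinTree, t.anti o = w := by
  induction n using Nat.strong_induction_on generalizing o w with
  | _ n ih =>
    rcases List.eq_nil_or_concat w with rfl | ⟨w, v, rfl⟩
    · exact ⟨nil, rfl⟩
    rw [List.concat_eq_append] at hw h ⊢
    obtain ⟨n, rfl⟩ : ∃ m, n = m + 1 := ⟨n - 1, by have := hw.length_eq; simp at this; omega⟩
    obtain ⟨a, b, hab, rfl, hl, hr⟩ := exists_filter_perm hw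
    have hs : ∀ u : List ℕ, u.Sublist w → u.Sublist (w ++ [o + a + 1]) := fun u hu =>
      hu.trans (List.sublist_append_left _ _)
    obtain ⟨l, el⟩ := ih a (by omega) hl fun x y z hxyz =>
      h x y z (hs _ (hxyz.trans List.filter_sublist))
    obtain ⟨r, er⟩ := ih b (by omega) hr fun x y z hxyz =>
      h x y z (hs _ (hxyz.trans List.filter_sublist))
    have hsize : l.size = a := by rw [← length_anti l o, el, hl.length_eq, List.length_range']
    refine ⟨node l r, ?_⟩
    have key := eq_filter_append_filter (fun x => !decide (x < o + a + 1)) (l := w) (by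
      intro x y hxy hy
      have hy0 : y ∈ w := hxy.subset (by simp)
      have hne : y ≠ o + a + 1 := by
        rintro rfl
        have hn : (w ++ [o + a + 1]).Nodup := hw.nodup_iff.2 List.nodup_range'
        exact (List.nodup_append.1 hn).2.2 _ hy0 _ (by simp) rfl
      have := h x y (o + a + 1) (hxy.append (List.Sublist.refl [o + a + 1]))
      simp at hy ⊢
      omega)
    simp only [Bool.not_not] at key
    rw [anti, hsize, el, er, ← key]

theorem not_sublist_post (t : BinTree) (o : ℕ) {a b c : ℕ} (h : [a, b, c].Sublist (t.post o))
    (h1 : b < c) : ¬ c < a := by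
  induction t generalizing o with
  | nil => simp [post] at h
  | node l r hl hr =>
    intro h2
    have hM : ∀ x ∈ r.post (o + l.size + 1) ++ [o + l.size + 1], o + l.size < x := by
      simp only [List.mem_append, mem_post, List.mem_singleton]; omega
    have hL : ∀ x ∈ l.post o, x ≤ o + l.size := fun x hx => (mem_post.1 hx).2
    rw [post, List.append_assoc] at h
    obtain ⟨u, v, e, hu, hv⟩ := List.sublist_append_iff.1 h
    rcases u with _ | ⟨x, _ | ⟨y, _ | ⟨z, u⟩⟩⟩
    · simp only [List.nil_append] at e
      subst e
      obtain ⟨u, v, e, hu, hv⟩ := List.sublist_append_iff.1 hv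
      rcases u with _ | ⟨x, _ | ⟨y, _ | ⟨z, u⟩⟩⟩
      · simp only [List.nil_append] at e
        subst e
        simpa using hv.length_le
      · simp only [List.cons_append, List.nil_append, List.cons.injEq] at e
        obtain ⟨rfl, rfl⟩ := e
        simpa using hv.length_le
      · simp only [List.cons_append, List.nil_append, List.cons.injEq] at e
        obtain ⟨rfl, rfl, rfl⟩ := e
        have hc := hv.subset (List.mem_singleton_self c)
        have hb := mem_post.1 (hu.subset (a := b) (by simp))
        rw [List.mem_singleton] at hc
        omega
      · simp only [List.cons_append, List.cons.injEq] at e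
        obtain ⟨rfl, rfl, rfl, e⟩ := e
        obtain ⟨rfl, rfl⟩ := List.nil_eq_append_iff.1 e
        exact hr _ hu h2
    · simp only [List.cons_append, List.nil_append, List.cons.injEq] at e
      obtain ⟨rfl, rfl⟩ := e
      have := hM b (hv.subset (by simp))
      have := hL a (hu.subset (by simp))
      omega
    · simp only [List.cons_append, List.nil_append, List.cons.injEq] at e
      obtain ⟨rfl, rfl, rfl⟩ := e
      have := hM c (hv.subset (by simp))
      have := hL a (hu.subset (by simp))
      omega
    · simp only [List.cons_append, List.cons.injEq] at e
      obtain ⟨rfl, rfl, rfl, e⟩ := e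
      obtain ⟨rfl, rfl⟩ := List.nil_eq_append_iff.1 e
      exact hl _ hu h2

theorem not_sublist_anti (t : BinTree) (o : ℕ) {a b c : ℕ} (h : [a, b, c].Sublist (t.anti o))
    (h1 : a < c) : ¬ c < b := by
  induction t generalizing o with
  | nil => simp [anti] at h
  | node l r hl hr =>
    intro h2
    have hM : ∀ x ∈ l.anti o ++ [o + l.size + 1], x ≤ o + l.size + 1 := by
      simp only [List.mem_append, mem_anti, List.mem_singleton]; omega
    have hR : ∀ x ∈ r.anti (o + l.size + 1), o + l.size + 1 < x := fun x hx => (mem_anti.1 hx).1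
    rw [anti, List.append_assoc] at h
    obtain ⟨u, v, e, hu, hv⟩ := List.sublist_append_iff.1 h
    rcases u with _ | ⟨x, _ | ⟨y, _ | ⟨z, u⟩⟩⟩
    · simp only [List.nil_append] at e
      subst e
      obtain ⟨u, v, e, hu, hv⟩ := List.sublist_append_iff.1 hv
      rcases u with _ | ⟨x, _ | ⟨y, _ | ⟨z, u⟩⟩⟩
      · simp only [List.nil_append] at e
        subst e
        simpa using hv.length_le
      · simp only [List.cons_append, List.nil_append, List.cons.injEq] at e
        obtain ⟨rfl, rfl⟩ := e
        simpa using hv.length_le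
      · simp only [List.cons_append, List.nil_append, List.cons.injEq] at e
        obtain ⟨rfl, rfl, rfl⟩ := e
        have hc := hv.subset (List.mem_singleton_self c)
        have hb := mem_anti.1 (hu.subset (a := b) (by simp))
        rw [List.mem_singleton] at hc
        omega
      · simp only [List.cons_append, List.cons.injEq] at e
        obtain ⟨rfl, rfl, rfl, e⟩ := e
        obtain ⟨rfl, rfl⟩ := List.nil_eq_append_iff.1 e
        exact hl _ hu h2
    · simp only [List.cons_append, List.nil_append, List.cons.injEq] at e
      obtain ⟨rfl, rfl⟩ := e
      have := hM c (hv.subset (by simp))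
      have := hR a (hu.subset (by simp))
      omega
    · simp only [List.cons_append, List.nil_append, List.cons.injEq] at e
      obtain ⟨rfl, rfl, rfl⟩ := e
      have := hM c (hv.subset (by simp))
      have := hR a (hu.subset (by simp))
      omega
    · simp only [List.cons_append, List.cons.injEq] at e
      obtain ⟨rfl, rfl, rfl, e⟩ := e
      obtain ⟨rfl, rfl⟩ := List.nil_eq_append_iff.1 e
      exact hr _ hu h2

theorem not_contains_post (t : BinTree) : ¬ Contains (t.post 0) [3, 1, 2] := by
  rw [contains_312_iff]
  rintro ⟨a, b, c, h, h1, h2⟩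
  exact t.not_sublist_post 0 h h1 h2

theorem not_contains_anti (t : BinTree) : ¬ Contains (t.anti 0) [1, 3, 2] := by
  rw [contains_132_iff]
  rintro ⟨a, b, c, h, h1, h2⟩
  exact t.not_sublist_anti 0 h h1 h2

/-! ### The pair of paths of a permutation -/

/-- A root comes after its whole subtree in postorder, so its position exceeds theirs: in the
rotation a right edge is an ascent and a left edge a descent. -/
theorem stepWord_rotPost (t : BinTree) (o : ℕ) :
    (stepWord (t.rotPost o)).map (fun s => if s = D then U else D) = t.canopy := by
  have hne : ∀ (t : BinTree) (o : ℕ), t ≠ nil → t.rotPost o ≠ [] := by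
    intro t o ht
    cases t with
    | nil => exact absurd rfl ht
    | node l r => simp [rotPost]
  have hmem : ∀ (t : BinTree) (o x : ℕ), x ∈ t.rotPost o → x ≤ o + t.size := by
    intro t o x hx
    rw [← List.mem_reverse, reverse_rotPost, mem_rotAnti, size_mirror] at hx
    exact hx.2
  induction t generalizing o with
  | nil => rfl
  | node l r hl hr =>
    have h : (stepWord ([o + l.size + r.size + 1] ++ l.rotPost o)).map
        (fun s => if s = D then U else D) = if l = nil then [] else U :: l.canopy := by
      rcases eq_or_ne l nil with rfl | hl0
      · rfl
      · rw [stepWord_append (by simp) (hne l o hl0), if_pos, if_neg hl0, ← hl o]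
        · simp [stepWord]
        · refine Drop.of_forall (by simp) (hne l o hl0) fun a ha b hb => ?_
          have := hmem _ _ _ hb
          rw [List.mem_singleton] at ha
          omega
    rw [rotPost, canopy, List.append_assoc, ← h]
    rcases eq_or_ne r nil with rfl | hr0
    · rfl
    · rw [stepWord_append (hne r _ hr0) (by simp), if_neg, if_neg hr0, ← hr (o + l.size)]
      · simp
      · rw [drop_append_right (by simp)]
        refine not_drop_of_forall fun a ha b hb => ?_
        have := hmem _ _ _ ha
        rw [List.mem_singleton] at hb
        omega

end BinTree

/-! ### Descent sets as step words -/

theorem getElem_stepWord (w : List ℕ) (i : ℕ) (h : i < (stepWord w).length) :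
    (stepWord w)[i] = if i + 1 ∈ Des w then D else U := by
  have hi : i + 1 < w.length := by
    rw [length_stepWord] at h
    omega
  have e : i + 1 ∈ Des w ↔ w[i + 1] < w[i] := by
    rw [Des, Finset.mem_filter, Finset.mem_Ico, add_tsub_cancel_right,
      List.getD_eq_getElem _ _ hi, List.getD_eq_getElem _ _ (by omega)]
    exact ⟨fun h => h.2, fun h => ⟨⟨by omega, hi⟩, h⟩⟩
  rw [if_congr e rfl rfl]
  clear e
  induction w generalizing i with
  | nil => simp at hi
  | cons a w ih =>
    obtain _ | ⟨b, w⟩ := w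
    · simp at hi
    obtain _ | i := i
    · rfl
    · exact ih i (by simpa [stepWord] using h) (by simpa using hi)

theorem DL_eq {k : ℕ} {w : List ℕ} (hw : w ∈ PermWords (2 * k + 1)) :
    DL k w = ((stepWord w).reverse, (stepWord (rot w)).map fun s => if s = D then U else D) := by
  have h1 := (mem_permWords_iff.1 hw).2.2
  have h2 := (mem_permWords_iff.1 (rot_mem_permWords hw)).2.2
  rw [DL, Prod.mk.injEq]
  constructor
  · refine List.ext_getElem (by simp [length_stepWord, h1]) fun i hi hi' => ?_
    simp only [List.length_map, List.length_range'] at hi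
    simp only [List.getElem_map, List.getElem_range', List.getElem_reverse, getElem_stepWord,
      length_stepWord, h1]
    rw [show 2 * k + 1 - (1 + 1 * i) = 2 * k + 1 - 1 - 1 - i + 1 by omega]
  · refine List.ext_getElem (by simp [length_stepWord, h2]) fun i hi hi' => ?_
    simp only [List.getElem_map, List.getElem_range', getElem_stepWord]
    rw [show 1 + 1 * i = i + 1 by omega]
    split_ifs <;> simp_all

theorem BinTree.DL_post {k : ℕ} {t : BinTree} (ht : t.size = 2 * k + 1) :
    DL k (t.post 0) = (t.edgePath, t.canopy) := by
  rw [DL_eq (ht ▸ t.post_mem_permWords), stepWord_post, List.reverse_reverse, rot_post,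
    stepWord_rotPost]

/-! ### Uniquely sorted avoiders as trees -/

theorem mem_uniquelySortedAv_iff {k : ℕ} {w τ : List ℕ} :
    w ∈ UniquelySortedAv (2 * k + 1) τ ↔
      w ∈ PermWords (2 * k + 1) ∧ TightWord w ∧ ¬ Contains w τ := by
  refine and_congr_right fun hw => and_congr_left' (isUniquelySorted_iff
    (isPermutation_of_mem_permWords hw) ?_)
  rintro rfl
  simpa using (mem_permWords_iff.1 hw).2.2

namespace BinTree

theorem exists_of_mem_uniquelySortedAv_132 {k : ℕ} {w : List ℕ}
    (hw : w ∈ UniquelySortedAv (2 * k + 1) [1, 3, 2]) :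
    ∃ t : BinTree, t.size = 2 * k + 1 ∧ t.lefts = k ∧ t.rights = k ∧ t.LeftHeavy ∧
      t.anti 0 = w := by
  obtain ⟨hp, ht, hc⟩ := mem_uniquelySortedAv_iff.1 hw
  rw [contains_132_iff] at hc
  obtain ⟨t, rfl⟩ := exists_anti_eq (o := 0) (n := 2 * k + 1) (by simpa [PermWords] using hp)
    fun a b c h h1 h2 => hc ⟨a, b, c, h, h1, h2⟩
  have hs := (mem_permWords_iff.1 hp).2.2
  rw [length_anti] at hs
  have h0 : t ≠ nil := by rintro rfl; simp [size] at hs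
  have he := lefts_eq_rights_of_anti ht
  have := size_eq h0
  exact ⟨t, hs, by omega, by omega, (tightWord_anti_iff h0 he).1 ht, rfl⟩

theorem exists_of_mem_uniquelySortedAv_312 {k : ℕ} {w : List ℕ}
    (hw : w ∈ UniquelySortedAv (2 * k + 1) [3, 1, 2]) :
    ∃ t : BinTree, t.size = 2 * k + 1 ∧ t.lefts = k ∧ t.rights = k ∧ TightWord (t.post 0) ∧
      t.post 0 = w := by
  obtain ⟨hp, ht, hc⟩ := mem_uniquelySortedAv_iff.1 hw
  rw [contains_312_iff] at hc
  obtain ⟨t, rfl⟩ := exists_post_eq (o := 0) (n := 2 * k + 1) (by simpa [PermWords] using hp)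
    fun a b c h h1 h2 => hc ⟨a, b, c, h, h1, h2⟩
  have hs := (mem_permWords_iff.1 hp).2.2
  rw [length_post] at hs
  have h0 : t ≠ nil := by rintro rfl; simp [size] at hs
  have he := lefts_eq_rights_of_post ht
  have := size_eq h0
  exact ⟨t, hs, by omega, by omega, ht, rfl⟩

theorem ne_nil_of_size {t : BinTree} {k : ℕ} (ht : t.size = 2 * k + 1) : t ≠ nil := by
  rintro rfl
  simp [size] at ht

theorem DL_post_mem_tamariIntervals_iff {t : BinTree} {k : ℕ} (hs : t.size = 2 * k + 1)
    (hl : t.lefts = k) (ht : TightWord (t.post 0)) :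
    DL k (t.post 0) ∈ tamariIntervals k ↔ t.LeftHeavy := by
  have h1 := edgePath_mem_dyckPaths ht
  have h2 := canopy_mem_dyckPaths ht
  rw [hl] at h1 h2
  rw [DL_post hs, leftHeavy_iff_tamariLE h1 h2]
  exact ⟨fun h => h.2.2, fun h => ⟨h1, h2, h⟩⟩

theorem post_mem_uniquelySortedAv {t : BinTree} {k : ℕ} (hs : t.size = 2 * k + 1)
    (ht : TightWord (t.post 0)) : t.post 0 ∈ UniquelySortedAv (2 * k + 1) [3, 1, 2] :=
  mem_uniquelySortedAv_iff.2 ⟨hs ▸ t.post_mem_permWords, ht, t.not_contains_post⟩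

theorem anti_mem_uniquelySortedAv {t : BinTree} {k : ℕ} (hs : t.size = 2 * k + 1)
    (ht : TightWord (t.anti 0)) : t.anti 0 ∈ UniquelySortedAv (2 * k + 1) [1, 3, 2] :=
  mem_uniquelySortedAv_iff.2 ⟨hs ▸ t.anti_mem_permWords, ht, t.not_contains_anti⟩

end BinTree
end CatalanIntervals

open CatalanIntervals CatalanIntervals.BinTree

theorem theorem4 (k : ℕ) :
    (∀ π ∈ UniquelySortedAv (2 * k + 1) [1, 3, 2],
      swl π ∈ UniquelySortedAv (2 * k + 1) [3, 1, 2]) ∧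
    Set.BijOn (fun π => DL k (swl π))
      (UniquelySortedAv (2 * k + 1) [1, 3, 2]) (tamariIntervals k) ∧
    (∀ π ∈ UniquelySortedAv (2 * k + 1) [3, 1, 2],
      IsSorted (swr π) ↔ DL k π ∈ tamariIntervals k) := by
  refine ⟨?_, ⟨?_, ?_, ?_⟩, ?_⟩
  · intro π hπ
    obtain ⟨t, hs, hl, hr, ht, rfl⟩ := exists_of_mem_uniquelySortedAv_132 hπ
    rw [swl_anti]
    exact post_mem_uniquelySortedAv hs (ht.tightWord_post (ne_nil_of_size hs) (by omega) 0)
  · intro π hπ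
    obtain ⟨t, hs, hl, hr, ht, rfl⟩ := exists_of_mem_uniquelySortedAv_132 hπ
    simp only [swl_anti]
    exact (DL_post_mem_tamariIntervals_iff hs hl
      (ht.tightWord_post (ne_nil_of_size hs) (by omega) 0)).2 ht
  · intro π hπ π' hπ' h
    obtain ⟨t, hs, hl, hr, ht, rfl⟩ := exists_of_mem_uniquelySortedAv_132 hπ
    obtain ⟨t', hs', hl', hr', ht', rfl⟩ := exists_of_mem_uniquelySortedAv_132 hπ'
    simp only [swl_anti, DL_post hs, DL_post hs', Prod.mk.injEq] at h
    rw [eq_of_edgePath_of_canopy (ne_nil_of_size hs) (ne_nil_of_size hs') h.1 h.2]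
  · rintro ⟨v, w⟩ ⟨hv, hw, hvw⟩
    -- The weaker order by height already produces the tree; the Tamari order is needed again only
    -- for its left-heaviness.
    obtain ⟨t, h0, rfl, rfl⟩ := exists_of_runSum_le hv hw fun j hj => hvw.runSum_le hv hw hj
    have hl : t.lefts = k := by rw [← t.count_edgePath.1, (count_of_mem_dyckPaths hv).1]
    have hr : t.rights = k := by rw [← t.count_edgePath.2, (count_of_mem_dyckPaths hv).2]
    have hs : t.size = 2 * k + 1 := by rw [size_eq h0]; omega
    have ht := (leftHeavy_iff_tamariLE hv hw).2 hvw
    refine ⟨t.anti 0, anti_mem_uniquelySortedAv hs (ht.tightWord_anti h0 (by omega) 0), ?_⟩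
    simp only [swl_anti, DL_post hs]
  · intro π hπ
    obtain ⟨t, hs, hl, hr, ht, rfl⟩ := exists_of_mem_uniquelySortedAv_312 hπ
    have h0 := ne_nil_of_size hs
    rw [DL_post_mem_tamariIntervals_iff hs hl ht, swr_post,
      isSorted_iff (isPermutation_of_mem_permWords t.anti_mem_permWords),
      ← tightWord_anti_iff_sortedWord h0 (by omega), tightWord_anti_iff h0 (by omega)]
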